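/- Let $r>0$, equip $\mathbb R^n$ with a norm $|\cdot|$, and let $C=C([-r,0],\mathbb R^n)$ with the supremum norm. For a function $x$ write $x_t(\omega)=x(t+\omega)$, $\omega\in[-r,0]$. Consider the linear delay equation $$x'(t)=L(t)x_t,\qquad L(t)\phi=\int_{[-r,0]}d\eta(t,\omega)\,\phi(\omega),\qquad (1)$$ where the matrix-valued kernel $\eta(t,\omega)$ is measurable in $(t,\omega)\in\mathbb R^2$, equals $0$ for $\omega\ge 0$ and $\eta(t,-r)$ for $\omega\le -r$, is left-continuous in $\omega\in(-r,0)$, and satisfies $\mathrm{Var}_{[-r,0]}\,\eta(t,\cdot)\le m(t)$ for some $m\in L^1_{loc}(\mathbb R)$. Solutions with initial time $s$ are locally absolutely continuous on $[s,\infty)$ and satisfy the equation for a.e. $t\ge s$. For $t\ge s$ let $T(t,s):C\to C$, $T(t,s)\phi=x_t$, where $x$ solves (1) with $x_s=\phi$. Let $T_0(t,s)\phi=x_t$ be defined in the same way (with Lebesgue–Stieltjes integrals) for $\phi\in C_0$, the space of functions on $[-r,0]$ that are continuous on $[-r,0)$ and have a limit as $\omega\to0^-$; the values of $T_0(t,s)$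 are bounded functions on $[-r,0]$, and all norms are supremum norms. **(H1)** Let $K,\tilde K\ge 1$, $N>1$, $\alpha,\beta>0$, $\theta,\nu,a\ge 0$, $\varepsilon>0$ be constants with $\theta\ge\varepsilon+\nu$, $\alpha>\theta+\varepsilon$ and $\beta>\nu+\varepsilon$. Let $\mu:\mathbb R\to(0,\infty)$ be a differentiable growth rate (strictly increasing, differentiable, $\mu(0)=1$, $\mu(t)\to\infty$ as $t\to+\infty$ and $\mu(t)\to0$ as $t\to-\infty$) with $\mu(s+r)/\mu(s)\le N$ for all $s\in\mathbb R$. Assume that $$\|T_0(t,s)\|\le\tilde K\Big(\frac{\mu(t)}{\mu(s)}\Big)^{\mathrm{sgn}(t-s)a}\mu(s)^{\mathrm{sgn}(s)\varepsilon}\qquad(t\ge s),$$ and that (1) has a nonuniform $\mu$-dichotomy on $\mathbb R$: there are bounded projections $P(s)$ on $C$, $s\in\mathbb R$, with $s\mapsto P(s)\phi$ continuous for every $\phi\in C$, such that, with $Q(s)=I-P(s)$ and $U(s)=Q(s)C$: 1. $T(t,s)P(s)=P(t)T(t,s)$ for $t\ge s$; 2. for $t\ge s$, $T(t,s)$ restricts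 to an isomorphism $U(s)\to U(t)$, whose inverse is denoted by $\overline T(s,t)$; 3. $\|T(t,s)P(s)\|\le K(\mu(t)/\mu(s))^{-\alpha}\mu(s)^{\mathrm{sgn}(s)\theta}$ for $t\ge s$; 4. $\|\overline T(t,s)Q(s)\|\le K(\mu(t)/\mu(s))^{\beta}\mu(s)^{\mathrm{sgn}(s)\nu}$ for $t\le s$. **(H2)** Let $g:\mathbb R\times C\to\mathbb R^n$ be continuous with $g(t,0)=0$ for all $t$, and let $\delta>0$ and $\gamma>\max\{\theta,\nu\}$ be such that, for all $t\in\mathbb R$ and $\phi,\psi\in C$, $$|g(t,\phi)-g(t,\psi)|\le\delta\min\{1,\|\phi-\psi\|\}\,\mu'(t)\,\mu(t)^{-\mathrm{sgn}(t)(\gamma+\varepsilon)-1}.$$ For $t\ge s$ let $R(t,s):C\to C$, $R(t,s)\phi=x_t$, where $x$ solves $x'(t)=L(t)x_t+g(t,x_t)$ with $x_s=\phi$. **Theorem.** There is $\delta_0>0$, depending only on the space $(\mathbb R^n,|\cdot|)$, on $r$ and on the constants $K,\tilde K,N,\alpha,\beta,\theta,\nu,a,\varepsilon$, such that whenever (H1)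 and (H2) hold with $\delta\le\delta_0$, there is a unique bounded continuous function $\zeta:\{(t,b):t\in\mathbb R,\ b\in U(t)\}\to C$ (the domain being a subspace of $\mathbb R\times C$) such that the maps $h^t=\mathrm{Id}_{U(t)}+\zeta(t,\cdot):U(t)\to C$ satisfy $$h^t\circ T(t,s)=R(t,s)\circ h^s\quad\text{on }U(s),\qquad\text{for all }t\ge s.$$ Moreover, for this $\zeta$, each $h^t$ is a homeomorphism of $U(t)$ onto its image in $C$. -/

import Mathlib

open Set Filter Topology MeasureTheory
open scoped ENNReal

noncomputable section

namespace DelayEq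

universe u

/-- The phase space `C = C([-r,0], E)` with the supremum norm. -/
abbrev Phase (r : ℝ) (E : Type u) [NormedAddCommGroup E] : Type u := C(Icc (-r) (0 : ℝ), E)

/-- The kernel `η(t, ω)` of a linear delay equation: a jointly measurable matrix-valued function
with `Var_{[-r,0]} η(t, ·) ≤ m(t)` for some locally integrable `m`, left-continuous in `ω ∈ (-r,0)`
and normalized by `η(t,ω) = 0` for `ω ≥ 0` and `η(t,ω) = η(t,-r)` for `ω ≤ -r`. -/
structure Kernel (r : ℝ) (E : Type u) [NormedAddCommGroup E] [NormedSpace ℝ E] where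
  toFun : ℝ → ℝ → (E →L[ℝ] E)
  measurable_toFun : Measurable (Function.uncurry toFun)
  eq_zero : ∀ t ω, 0 ≤ ω → toFun t ω = 0
  eq_left : ∀ t ω, ω ≤ -r → toFun t ω = toFun t (-r)
  leftContinuous : ∀ t ω, -r < ω → ω < 0 → ContinuousWithinAt (toFun t) (Iic ω) ω
  variation_le : ∃ m : ℝ → ℝ, LocallyIntegrable m volume ∧
    ∀ t, eVariationOn (toFun t) (Icc (-r) 0) ≤ ENNReal.ofReal (m t)

variable {r : ℝ} {E : Type u} [NormedAddCommGroup E] [NormedSpace ℝ E]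

/-- Being constant outside `[-r,0]`, the function `η(t, ·)` has bounded variation on the line. -/
theorem Kernel.boundedVariationOn (η : Kernel r E) (t : ℝ) :
    BoundedVariationOn (η.toFun t) univ := by
  obtain ⟨m, -, hm⟩ := η.variation_le
  rcases le_or_gt 0 r with hr | hr
  · have h1 : η.toFun t = η.toFun t ∘ fun ω => max (-r) (min ω 0) := by
      funext ω
      rcases le_total ω (-r) with h | h
      · simp [min_eq_left (h.trans (by linarith : -r ≤ 0)), max_eq_left h, η.eq_left t ω h]
      · rcases le_total ω 0 with h' | h'
        · simp [min_eq_left h', max_eq_right h]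
        · simp [min_eq_right h', hr, η.eq_zero t ω h', η.eq_zero t 0 le_rfl]
    have h2 : eVariationOn (η.toFun t ∘ fun ω => max (-r) (min ω 0)) univ ≤
        eVariationOn (η.toFun t) (Icc (-r) 0) := by
      refine eVariationOn.comp_le_of_monotoneOn _ _ ?_ ?_
      · intro x _ y _ hxy
        exact max_le_max le_rfl (min_le_min hxy le_rfl)
      · intro x _
        exact ⟨le_max_left _ _, max_le (by linarith) (min_le_right _ _)⟩
    rw [← h1] at h2
    exact ne_top_of_le_ne_top ENNReal.ofReal_ne_top (h2.trans (hm t))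
  · have h1 : η.toFun t = fun _ => 0 := by
      funext ω
      rcases le_total ω (-r) with h | h
      · rw [η.eq_left t ω h, η.eq_zero t (-r) (by linarith)]
      · exact η.eq_zero t ω (by linarith)
    rw [h1]
    have : eVariationOn (fun _ : ℝ => (0 : E →L[ℝ] E)) univ = 0 :=
      eVariationOn.constant_on (by
        rintro _ ⟨_, _, rfl⟩ _ ⟨_, _, rfl⟩
        rfl)
    simp [BoundedVariationOn, this]

/-- The linear operator `L(t) ψ = ∫_{[-r,0]} dη(t,ω) ψ(ω)` (Lebesgue-Stieltjes integral), acting on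
`C` and, by the same formula, on all bounded Borel functions `ψ : [-r,0] → E`. (The function `ψ` is
extended by zero; the measure `dη(t, ·)` is carried by `[-r,0]`.) -/
def Kernel.L [CompleteSpace E] (η : Kernel r E) (t : ℝ) (ψ : Icc (-r) (0 : ℝ) → E) : E :=
  ∫ᵛ ω, Function.extend Subtype.val ψ 0 ω
    ∂[ContinuousLinearMap.apply ℝ E; (η.boundedVariationOn t).vectorMeasure]

/-- The segment `x_t(ω) = x(t + ω)`, `ω ∈ [-r,0]`. -/
def segment (r : ℝ) (x : ℝ → E) (t : ℝ) : Icc (-r) (0 : ℝ) → E := fun ω => x (t + ω)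

open Classical in
/-- A continuous function on `[-r,0]`, as an element of `C` (zero for discontinuous functions). -/
def toPhase (ψ : Icc (-r) (0 : ℝ) → E) : Phase r E :=
  if h : Continuous ψ then ⟨ψ, h⟩ else 0

/-- `x` is a solution on `[s-r, ∞)` of the delay equation `x'(t) = F(t, x_t)`, `x_s = φ`:
it is locally absolutely continuous on `[s, ∞)` and satisfies the equation for a.e. `t ≥ s`. -/
structure IsSolution (F : ℝ → (Icc (-r) (0 : ℝ) → E) → E) (s : ℝ)
    (φ : Icc (-r) (0 : ℝ) → E) (x : ℝ → E) : Prop where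
  initial : segment r x s = φ
  absolutelyContinuous : ∀ b, s ≤ b → AbsolutelyContinuousOnInterval x s b
  equation : ∀ᵐ t ∂(volume : Measure ℝ), s ≤ t → HasDerivAt x (F t (segment r x t)) t

open Classical in
/-- The evolution `φ ↦ x_t`, where `x` is the solution of `x'(t) = F(t, x_t)`, `x_s = φ`
(zero if there is none). -/
def evolution (F : ℝ → (Icc (-r) (0 : ℝ) → E) → E) (t s : ℝ)
    (φ : Icc (-r) (0 : ℝ) → E) : Icc (-r) (0 : ℝ) → E :=
  if h : ∃ x, IsSolution F s φ x then segment r h.choose t else 0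

variable [CompleteSpace E]

/-- The operators `T(t,s)` on `C` of the linear equation `x'(t) = L(t) x_t`. -/
def T (η : Kernel r E) (t s : ℝ) (φ : Phase r E) : Phase r E :=
  toPhase (evolution η.L t s φ)

/-- The extension `T₀(t,s)` of `T(t,s)`. For initial data in `C₀`, which may jump at `ω = 0`, the
values are bounded functions on `[-r,0]`, which may have a jump. -/
def T₀ (η : Kernel r E) (t s : ℝ) (φ : Icc (-r) (0 : ℝ) → E) : Icc (-r) (0 : ℝ) → E :=
  evolution η.L t s φ

/-- The operators `R(t,s)` on `C` of the perturbed equation `x'(t) = L(t) x_t + g(t, x_t)`. -/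
def R (η : Kernel r E) (g : ℝ → Phase r E → E) (t s : ℝ) (φ : Phase r E) : Phase r E :=
  toPhase (evolution (fun τ ψ => η.L τ ψ + g τ (toPhase ψ)) t s φ)

/-- The space `C₀` of the functions on `[-r,0]` that are continuous on `[-r,0)` and have a limit
as `ω → 0⁻`. -/
def C₀ (r : ℝ) (E : Type u) [NormedAddCommGroup E] : Set (Icc (-r) (0 : ℝ) → E) :=
  {φ | ContinuousOn φ {ω | (ω : ℝ) < 0} ∧
    ∀ ω₀ : Icc (-r) (0 : ℝ), (ω₀ : ℝ) = 0 → ∃ l, Tendsto φ (𝓝[<] ω₀) (𝓝 l)}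

/-- `μ` is a differentiable growth rate. -/
structure IsDiffGrowthRate (μ : ℝ → ℝ) : Prop where
  pos : ∀ t, 0 < μ t
  strictMono : StrictMono μ
  map_zero : μ 0 = 1
  tendsto_atTop : Tendsto μ atTop atTop
  tendsto_atBot : Tendsto μ atBot (𝓝 0)
  differentiable : Differentiable ℝ μ

/-- `T₀(t,s)` has nonuniform `μ`-bounded growth with the constants `K'`, `a` and parameter `ε`:
`‖T₀(t,s)‖ ≤ K' (μ(t)/μ(s))^{sgn(t-s) a} μ(s)^{sgn(s) ε}` for `t ≥ s`, for the supremum norm. -/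
def HasBoundedGrowth (η : Kernel r E) (μ : ℝ → ℝ) (K' a ε : ℝ) : Prop :=
  ∀ s t, s ≤ t → ∀ φ ∈ C₀ r E, ∀ ω,
    ‖T₀ η t s φ ω‖ ≤ K' * (μ t / μ s) ^ (Real.sign (t - s) * a) * μ s ^ (Real.sign s * ε)
      * ⨆ ω', ‖φ ω'‖

/-- The unstable subspace `U(t)`, the range of `Q(t) = I - P(t)`. -/
def U (P : ℝ → Phase r E →L[ℝ] Phase r E) (t : ℝ) : Set (Phase r E) :=
  range fun φ => φ - P t φ

/-- For `t ≤ s`, the inverse of the restriction `T(s,t) : U(t) → U(s)`. -/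
def Tbar (η : Kernel r E) (P : ℝ → Phase r E →L[ℝ] Phase r E) (t s : ℝ) :
    Phase r E → Phase r E :=
  Function.invFunOn (T η s t) (U P t)

/-- The projections `P(s)` form a nonuniform `μ`-dichotomy of `x'(t) = L(t) x_t` on `ℝ` with the
constants `K`, `α`, `β`, `θ`, `ν`. -/
structure IsDichotomy (η : Kernel r E) (μ : ℝ → ℝ) (P : ℝ → Phase r E →L[ℝ] Phase r E)
    (K α β θ ν : ℝ) : Prop where
  proj : ∀ s φ, P s (P s φ) = P s φ
  stronglyContinuous : ∀ φ, Continuous fun s => P s φ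
  invariant : ∀ s t, s ≤ t → ∀ φ, T η t s (P s φ) = P t (T η t s φ)
  bijOn : ∀ s t, s ≤ t → BijOn (T η t s) (U P s) (U P t)
  stable : ∀ s t, s ≤ t → ∀ φ,
    ‖T η t s (P s φ)‖ ≤ K * (μ t / μ s) ^ (-α) * μ s ^ (Real.sign s * θ) * ‖φ‖
  unstable : ∀ s t, t ≤ s → ∀ φ,
    ‖Tbar η P t s (φ - P s φ)‖ ≤ K * (μ t / μ s) ^ β * μ s ^ (Real.sign s * ν) * ‖φ‖

/-- The perturbation `g` is continuous, vanishes at `φ = 0` and satisfies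
`|g(t,φ) - g(t,ψ)| ≤ δ min{1, ‖φ - ψ‖} μ'(t) μ(t)^{-sgn(t)(γ+ε)-1}`. -/
structure IsPerturbation (μ : ℝ → ℝ) (g : ℝ → Phase r E → E) (δ γ ε : ℝ) : Prop where
  continuous : Continuous (Function.uncurry g)
  map_zero : ∀ t, g t 0 = 0
  lipschitz : ∀ t φ ψ, ‖g t φ - g t ψ‖ ≤
    δ * min 1 ‖φ - ψ‖ * deriv μ t * μ t ^ (-(Real.sign t * (γ + ε)) - 1)

/-- The set `{(t,b) : t ∈ ℝ, b ∈ U(t)}`, as a subspace of `ℝ × C`. -/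
abbrev UnstableBundle (P : ℝ → Phase r E →L[ℝ] Phase r E) : Type u :=
  {p : ℝ × Phase r E // p.2 ∈ U P p.1}

/-- The map `h^t = Id + ζ^t : U(t) → C` for a bounded continuous `ζ` on the unstable bundle. -/
def h {P : ℝ → Phase r E →L[ℝ] Phase r E}
    (ζ : BoundedContinuousFunction (UnstableBundle P) (Phase r E)) (t : ℝ) (b : U P t) :
    Phase r E :=
  b + ζ ⟨(t, b), b.2⟩

/-- `h^t ∘ T(t,s) = R(t,s) ∘ h^s` on `U(s)`, for all `t ≥ s`. -/
def IsConjugacy {η : Kernel r E} {μ : ℝ → ℝ} {P : ℝ → Phase r E →L[ℝ] Phase r E}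
    {K α β θ ν : ℝ} (hP : IsDichotomy η μ P K α β θ ν) (g : ℝ → Phase r E → E)
    (ζ : BoundedContinuousFunction (UnstableBundle P) (Phase r E)) : Prop :=
  ∀ s t (hst : s ≤ t) (b : U P s),
    h ζ t ⟨T η t s b, (hP.bijOn s t hst).mapsTo b.2⟩ = R η g t s (h ζ s b)

end DelayEq

end

/-!
The proof is Perron's method, carried out orbit by orbit. Write `u = log μ`. Since `log μ(t)` has
the sign of `t`, the weights `μ(t)^{sgn(t)x}` are `e^{x|u(t)|}`.

*From conjugacies to bounded solutions.* A point `b` of the unstable space `U(s)` lies on a unique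
complete orbit `y` of the linear equation with values in the unstable spaces. A bounded continuous
`ζ` is a conjugacy if and only if, along each such orbit, `v(t) = ζ(t, y(t))` makes `y + v` a
complete solution of the perturbed equation (`isConjugacy_iff`, `isDeviation_iff`). By variation of
constants this says that `v` is a bounded solution of the linear equation with forcing
`f(t) = g(t, y(t) + v(t))`, that is, `v(t) = T(t,s)v(s) + V(t,s)` for all `s ≤ t`, where `V(t,s)` is
the `response`: the segment at time `t` of the forced solution that vanishes at time `s`.

*Bounded solutions.* Let `|f| ≤ D u' e^{-(θ+ε)|u|}`. The forced equation has at most one bounded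
complete solution by the dichotomy (`IsLogDichotomy.eq_zero_of_bounded`). One is given by Perron's
formula: the stable part is the limit of `P(t)V(t,s)` as `s → -∞`, and the unstable part is the
limit of the backward continuations of `-Q(s)V(s,t)` as `s → ∞`
(`IsLogDichotomy.exists_bounded_solution`). The usual form of this formula integrates `T₀(t,s)`
applied to functions with a jump at `ω = 0`. Working with the continuous functions `V(t,s)` and the
identity `V(t,s) = T(t,c)V(c,s) + V(t,c)` avoids discontinuous data: over very short times a crude
Gronwall estimate bounds `V` with an absolute constant, bounded growth turns this into a bound
`‖V(t,s)‖ ≤ A D e^{-θ|u(t)|}(u(t) - u(s))` over times up to `r`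
(`IsLBound.norm_response_le_of_growth`), and summing over steps of length at most `r` with the
dichotomy estimates gives telescoping sums of exponentials. The result is `‖v‖ ≤ C D` with `C`
depending only on the given constants.

*The fixed point.* For `C δ ≤ 1/2` the map that sends `v` to the bounded solution with forcing
`g(·, y + v)` is a contraction of the bounded continuous curves, so that each orbit has exactly one
deviation `v` (`exists_isDeviation`, `IsDeviation.ext`). This gives `ζ` and its uniqueness.

*Continuity.* As `γ > θ`, the deviation depends in a Lipschitz way on `y` with respect to
`sup_t min(1, ‖y(t) - y'(t)‖) e^{-(γ-θ)|u(t)|}`, and orbits close at one time are close in this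
sense: in the past by the dichotomy, on compact intervals by continuous dependence, and in the far
future because of the weight (`IsOrbit.exists_forall_min_le`, `tendsto_deviation`).

*Embedding.* If `h^t(b)` is close to `h^t(b₀)`, then for any fixed `τ ≥ t` the images under `R(τ,t)`
are close, so that `T(τ,t)(b - b₀)` is bounded by `1 + 2‖ζ‖`; the backward contraction on the
unstable spaces makes `b - b₀` small if `τ` is large (`IsConjugacy.isEmbedding`).
-/

noncomputable section

/-! ### Stieltjes vector measures -/

theorem iUnion_Ioc_neg_natCast : ⋃ n : ℕ, Ioc (-(n : ℝ)) n = univ := by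
  refine eq_univ_of_forall fun x => ?_
  obtain ⟨n, hn⟩ := exists_nat_gt |x|
  have := abs_lt.1 hn
  exact mem_iUnion.2 ⟨n, this.1, this.2.le⟩

theorem monotone_Ioc_neg_natCast : Monotone fun n : ℕ => Ioc (-(n : ℝ)) n := by
  intro m n hmn
  have : (m : ℝ) ≤ n := by exact_mod_cast hmn
  exact Ioc_subset_Ioc (by linarith) this

theorem measurableSpace_eq_generateFrom_Ioc : (inferInstance : MeasurableSpace ℝ) =
    MeasurableSpace.generateFrom {s | ∃ u v : ℝ, u ≤ v ∧ s = Ioc u v} := by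
  borelize ℝ
  refine (borel_eq_generateFrom_Ioc_le ℝ).trans ?_
  congr 1
  ext s
  simp only [mem_ofPred_eq]
  grind

/-- The total variation of the Stieltjes measure of `f` is at most the variation of `f`: on
half-open intervals the vector measure is dominated by the positive Stieltjes measure of the
variation function of `f.rightLim`, and this determines it. -/
theorem BoundedVariationOn.variation_vectorMeasure_univ_le {F : Type*} [NormedAddCommGroup F]
    [CompleteSpace F] {f : ℝ → F} (hf : BoundedVariationOn f univ) :
    hf.vectorMeasure.variation univ ≤ eVariationOn f univ := by
  set S := hf.stieltjesFunctionRightLim 0 with hS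
  have hIoc (u v : ℝ) (huv : u ≤ v) :
      S.measure (Ioc u v) = eVariationOn f.rightLim (Icc u v) := by
    rw [StieltjesFunction.measure_Ioc, hS, BoundedVariationOn.stieltjesFunctionRightLim_apply,
      BoundedVariationOn.stieltjesFunctionRightLim_apply,
      ← variationOnFromTo.add hf.rightLim.locallyBoundedVariationOn
        (mem_univ 0) (mem_univ u) (mem_univ v), add_sub_cancel_left, variationOnFromTo,
      if_pos huv, univ_inter, ENNReal.ofReal_toReal]
    exact ((eVariationOn.mono _ (subset_univ _)).trans_lt hf.rightLim.lt_top).ne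
  have huniv : S.measure univ ≤ eVariationOn f univ := by
    have h3 : S.measure univ = ⨆ n : ℕ, S.measure (Ioc (-(n : ℝ)) n) := by
      rw [← iUnion_Ioc_neg_natCast]
      exact monotone_Ioc_neg_natCast.measure_iUnion
    rw [h3]
    refine iSup_le fun n => ?_
    have hn : (0 : ℝ) ≤ n := n.cast_nonneg
    rw [hIoc _ _ (by linarith)]
    exact (eVariationOn.mono _ (subset_univ _)).trans
      (eVariationOn.eVariationOn_rightLim_le isOpen_univ)
  have hfin : IsFiniteMeasure S.measure := ⟨huniv.trans_lt hf.lt_top⟩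
  obtain ⟨m', hm', hle⟩ :=
    VectorMeasure.exists_extension_of_isSetSemiring_of_le_measure_of_generateFrom
      (μ := S.measure) (m := AddContent.onIoc f.rightLim) IsSetSemiring.Ioc (by
        rintro s ⟨u, v, huv, rfl⟩
        rw [AddContent.onIoc_apply huv, hIoc u v huv, ← edist_eq_enorm_sub]
        exact eVariationOn.edist_le _ (by grind) (by grind)) measurableSpace_eq_generateFrom_Ioc
  have hIoc' (u v : ℝ) (huv : u ≤ v) : m' (Ioc u v) = hf.vectorMeasure (Ioc u v) := by
    rw [hm' _ ⟨u, v, huv, rfl⟩, AddContent.onIoc_apply huv, hf.vectorMeasure_Ioc huv]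
  have hEq : m' = hf.vectorMeasure := by
    refine VectorMeasure.ext_of_generateFrom _ ?_ measurableSpace_eq_generateFrom_Ioc
      IsSetSemiring.Ioc.isPiSystem ?_
    · rintro s ⟨u, v, huv, rfl⟩
      exact hIoc' u v huv
    · have h3 := m'.tendsto_vectorMeasure_iUnion_atTop_nat monotone_Ioc_neg_natCast
        (fun n => measurableSet_Ioc)
      have h4 := hf.vectorMeasure.tendsto_vectorMeasure_iUnion_atTop_nat monotone_Ioc_neg_natCast
        (fun n => measurableSet_Ioc)
      rw [iUnion_Ioc_neg_natCast] at h3 h4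
      refine tendsto_nhds_unique h3 (h4.congr fun n => (hIoc' _ _ ?_).symm)
      have : (0 : ℝ) ≤ n := n.cast_nonneg
      linarith
  rw [← hEq]
  exact (VectorMeasure.variation_le_of_forall_enorm_le (fun s _ => hle s) univ).trans huniv

namespace DelayEq

universe u

/-! ### The operators of the linear equation -/

section KernelOperator

variable {r : ℝ} {E : Type u} [NormedAddCommGroup E] [NormedSpace ℝ E]

theorem Kernel.eVariationOn_univ_le (η : Kernel r E) (hr : 0 < r) (t : ℝ) :
    eVariationOn (η.toFun t) univ ≤ eVariationOn (η.toFun t) (Icc (-r) 0) := by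
  have h1 : η.toFun t = η.toFun t ∘ fun ω => max (-r) (min ω 0) := by
    funext ω
    rcases le_total ω (-r) with h | h
    · simp [min_eq_left (h.trans (by linarith : -r ≤ 0)), max_eq_left h, η.eq_left t ω h]
    · rcases le_total ω 0 with h' | h'
      · simp [min_eq_left h', max_eq_right h]
      · simp [min_eq_right h', hr.le, η.eq_zero t ω h', η.eq_zero t 0 le_rfl]
  conv_lhs => rw [h1]
  refine eVariationOn.comp_le_of_monotoneOn _ _ ?_ ?_
  · intro x _ y _ hxy
    exact max_le_max le_rfl (min_le_min hxy le_rfl)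
  · intro x _
    exact ⟨le_max_left _ _, max_le (by linarith) (min_le_right _ _)⟩

omit [NormedSpace ℝ E] in
/-- The extension by zero of a continuous function on `[-r,0]` is strongly measurable. -/
theorem stronglyMeasurable_extend (ψ : Phase r E) :
    StronglyMeasurable (Function.extend (Subtype.val : Icc (-r) (0 : ℝ) → ℝ) ψ 0) := by
  by_cases hr : -r ≤ 0
  · have h : Function.extend (Subtype.val : Icc (-r) (0 : ℝ) → ℝ) ψ 0 =
        (Icc (-r) (0 : ℝ)).indicator (IccExtend hr ψ) := by
      funext ω
      by_cases hω : ω ∈ Icc (-r) (0 : ℝ)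
      · rw [indicator_of_mem hω, IccExtend_of_mem hr _ hω]
        exact Subtype.val_injective.extend_apply ψ 0 ⟨ω, hω⟩
      · rw [indicator_of_notMem hω, Function.extend_apply' _ _ _ (by rintro ⟨a, rfl⟩; exact hω a.2)]
        rfl
    rw [h]
    exact (ψ.continuous.Icc_extend' (h := hr)).stronglyMeasurable.indicator measurableSet_Icc
  · have h : Function.extend (Subtype.val : Icc (-r) (0 : ℝ) → ℝ) ψ 0 = 0 := by
      funext ω
      refine Function.extend_apply' _ _ _ ?_
      rintro ⟨a, -⟩
      exact hr (a.2.1.trans a.2.2)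
    rw [h]
    exact stronglyMeasurable_zero

omit [NormedSpace ℝ E] in
theorem norm_extend_le (ψ : Phase r E) (ω : ℝ) :
    ‖Function.extend (Subtype.val : Icc (-r) (0 : ℝ) → ℝ) ψ 0 ω‖ ≤ ‖ψ‖ := by
  by_cases hω : ∃ a : Icc (-r) (0 : ℝ), (a : ℝ) = ω
  · obtain ⟨a, rfl⟩ := hω
    rw [Subtype.val_injective.extend_apply]
    exact ψ.norm_coe_le_norm a
  · rw [Function.extend_apply' _ _ _ hω]
    simp

variable [CompleteSpace E]

instance Kernel.isFiniteMeasure_variation (η : Kernel r E) (t : ℝ) :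
    IsFiniteMeasure (η.boundedVariationOn t).vectorMeasure.variation :=
  ⟨(η.boundedVariationOn t).variation_vectorMeasure_univ_le.trans_lt
    (η.boundedVariationOn t).lt_top⟩

theorem Kernel.integrable_extend (η : Kernel r E) (t : ℝ) (ψ : Phase r E) :
    (η.boundedVariationOn t).vectorMeasure.Integrable
      (Function.extend (Subtype.val : Icc (-r) (0 : ℝ) → ℝ) ψ 0) :=
  Integrable.of_bound (stronglyMeasurable_extend ψ).aestronglyMeasurable ‖ψ‖
    (Eventually.of_forall (norm_extend_le ψ))

theorem Kernel.L_add (η : Kernel r E) (t : ℝ) (φ ψ : Phase r E) :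
    η.L t (φ + ψ) = η.L t φ + η.L t ψ := by
  have h := (VectorMeasure.integral_fun_add (B := ContinuousLinearMap.apply ℝ E)
    (η.integrable_extend t φ) (η.integrable_extend t ψ))
  unfold Kernel.L
  rw [← h]
  congr 1
  funext ω
  by_cases hω : ∃ a : Icc (-r) (0 : ℝ), (a : ℝ) = ω
  · obtain ⟨a, rfl⟩ := hω
    simp
  · simp [Function.extend_apply' _ _ _ hω]

theorem Kernel.L_smul (η : Kernel r E) (t : ℝ) (c : ℝ) (φ : Phase r E) :
    η.L t (c • φ) = c • η.L t φ := by
  unfold Kernel.L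
  rw [← VectorMeasure.integral_fun_smul]
  congr 1
  funext ω
  by_cases hω : ∃ a : Icc (-r) (0 : ℝ), (a : ℝ) = ω
  · obtain ⟨a, rfl⟩ := hω
    simp
  · simp [Function.extend_apply' _ _ _ hω]

theorem Kernel.norm_L_le (η : Kernel r E) (t : ℝ) (φ : Phase r E) :
    ‖η.L t φ‖ ≤ ‖φ‖ * ‖ContinuousLinearMap.apply ℝ E (E := E)‖ *
      (eVariationOn (η.toFun t) univ).toReal := by
  refine (VectorMeasure.norm_integral_le_of_norm_le_const
    (Eventually.of_forall (norm_extend_le φ))).trans ?_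
  refine mul_le_mul_of_nonneg_left ?_ (by positivity)
  exact ENNReal.toReal_mono (η.boundedVariationOn t).lt_top.ne
    (η.boundedVariationOn t).variation_vectorMeasure_univ_le

/-- `L(t)` as a continuous linear map on the phase space. -/
def Kernel.LC (η : Kernel r E) (t : ℝ) : Phase r E →L[ℝ] E :=
  LinearMap.mkContinuous
    { toFun := fun φ => η.L t φ
      map_add' := fun φ ψ => η.L_add t φ ψ
      map_smul' := fun c φ => η.L_smul t c φ }
    (‖ContinuousLinearMap.apply ℝ E (E := E)‖ * (eVariationOn (η.toFun t) univ).toReal)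
    (fun φ => (η.norm_L_le t φ).trans (le_of_eq (by ring)))

@[simp]
theorem Kernel.LC_apply (η : Kernel r E) (t : ℝ) (φ : Phase r E) : η.LC t φ = η.L t φ := rfl

/-- The operator norm of `L(t)` is bounded by a multiple of the variation of `η(t, ·)`, and hence
by a locally integrable function. -/
theorem Kernel.exists_norm_LC_le (η : Kernel r E) (hr : 0 < r) :
    ∃ ℓ : ℝ → ℝ, LocallyIntegrable ℓ volume ∧ (∀ t, 0 ≤ ℓ t) ∧ ∀ t φ, ‖η.LC t φ‖ ≤ ℓ t * ‖φ‖ := by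
  obtain ⟨m, hm, hvar⟩ := η.variation_le
  refine ⟨fun t => ‖ContinuousLinearMap.apply ℝ E (E := E)‖ * ‖m t‖, ?_, fun t => by positivity, ?_⟩
  · exact LocallyIntegrable.smul (fun x => (hm x).norm) ‖ContinuousLinearMap.apply ℝ E (E := E)‖
  · intro t φ
    refine (η.norm_L_le t φ).trans ?_
    have h : (eVariationOn (η.toFun t) univ).toReal ≤ ‖m t‖ := by
      refine (ENNReal.toReal_mono ENNReal.ofReal_ne_top
        ((η.eVariationOn_univ_le hr t).trans (hvar t))).trans ?_
      rw [ENNReal.toReal_ofReal']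
      exact max_le (le_abs_self _) (abs_nonneg _)
    calc _ = ‖ContinuousLinearMap.apply ℝ E (E := E)‖ *
          (eVariationOn (η.toFun t) univ).toReal * ‖φ‖ := by ring
      _ ≤ _ := by
        refine mul_le_mul_of_nonneg_right ?_ (norm_nonneg _)
        exact mul_le_mul_of_nonneg_left h (by positivity)

variable [FiniteDimensional ℝ E]

theorem Kernel.stronglyMeasurable_rightLim (η : Kernel r E) (b : ℝ) :
    StronglyMeasurable fun t => (η.toFun t).rightLim b := by
  have : ProperSpace (E →L[ℝ] E) := FiniteDimensional.proper_real _
  refine stronglyMeasurable_of_tendsto (f := fun (n : ℕ) t => η.toFun t (b + 1 / ((n : ℝ) + 1)))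
    atTop (fun n => ?_) (tendsto_pi_nhds.2 fun t => ?_)
  · exact (η.measurable_toFun.comp (measurable_id.prodMk measurable_const)).stronglyMeasurable
  · refine ((η.boundedVariationOn t).tendsto_rightLim b).comp
      (tendsto_nhdsWithin_iff.2 ⟨?_, Eventually.of_forall fun n => ?_⟩)
    · simpa using tendsto_const_nhds.add (tendsto_one_div_add_atTop_nhds_zero_nat (𝕜 := ℝ))
    · have : (0 : ℝ) < 1 / ((n : ℝ) + 1) := by positivity
      simpa using this

/-- The measures `dη(t, ·)` depend measurably on `t`. -/
theorem Kernel.stronglyMeasurable_vectorMeasure (η : Kernel r E) {s : Set ℝ}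
    (hs : MeasurableSet s) :
    StronglyMeasurable fun t => (η.boundedVariationOn t).vectorMeasure s := by
  have hbasic (u v : ℝ) (huv : u ≤ v) :
      StronglyMeasurable fun t => (η.boundedVariationOn t).vectorMeasure (Ioc u v) := by
    have : (fun t => (η.boundedVariationOn t).vectorMeasure (Ioc u v)) =
        fun t => (η.toFun t).rightLim v - (η.toFun t).rightLim u := by
      funext t
      exact (η.boundedVariationOn t).vectorMeasure_Ioc huv
    rw [this]
    exact (η.stronglyMeasurable_rightLim v).sub (η.stronglyMeasurable_rightLim u)
  have huniv : StronglyMeasurable fun t => (η.boundedVariationOn t).vectorMeasure univ := by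
    refine stronglyMeasurable_of_tendsto
      (f := fun (n : ℕ) t => (η.boundedVariationOn t).vectorMeasure (Ioc (-(n : ℝ)) n))
      atTop (fun n => hbasic _ _ ?_) (tendsto_pi_nhds.2 fun t => ?_)
    · have : (0 : ℝ) ≤ n := n.cast_nonneg
      linarith
    · have := (η.boundedVariationOn t).vectorMeasure.tendsto_vectorMeasure_iUnion_atTop_nat
        monotone_Ioc_neg_natCast (fun n => measurableSet_Ioc)
      rwa [iUnion_Ioc_neg_natCast] at this
  induction s, hs using MeasurableSpace.induction_on_inter
    measurableSpace_eq_generateFrom_Ioc IsSetSemiring.Ioc.isPiSystem with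
  | empty => simpa using stronglyMeasurable_const
  | basic s hs =>
    obtain ⟨u, v, huv, rfl⟩ := hs
    exact hbasic u v huv
  | compl s hs ih =>
    simp_rw [VectorMeasure.of_compl hs]
    exact huniv.sub ih
  | iUnion f hd hm ih =>
    refine stronglyMeasurable_of_tendsto
      (f := fun (n : ℕ) t => ∑ i ∈ Finset.range n, (η.boundedVariationOn t).vectorMeasure (f i))
      atTop (fun n => Finset.stronglyMeasurable_fun_sum _ fun i _ => ih i)
      (tendsto_pi_nhds.2 fun t => ?_)
    exact ((η.boundedVariationOn t).vectorMeasure.m_iUnion hm hd).tendsto_sum_nat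

/-- `L(t)ψ` depends measurably on `t`: the integral of a simple function does, and `ψ` is a
bounded pointwise limit of simple functions. -/
theorem Kernel.stronglyMeasurable_LC (η : Kernel r E) (ψ : Phase r E) :
    StronglyMeasurable fun t => η.LC t ψ := by
  have hsimple (f : SimpleFunc ℝ E) : StronglyMeasurable fun t =>
      VectorMeasure.integral (η.boundedVariationOn t).vectorMeasure f
        (ContinuousLinearMap.apply ℝ E) := by
    induction f using SimpleFunc.induction with
    | const c hs =>
      rename_i s
      have : (fun t => VectorMeasure.integral (η.boundedVariationOn t).vectorMeasure
          (SimpleFunc.piecewise s hs (SimpleFunc.const ℝ c) (SimpleFunc.const ℝ 0))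
          (ContinuousLinearMap.apply ℝ E)) =
          fun t => (η.boundedVariationOn t).vectorMeasure s c := by
        funext t
        have := VectorMeasure.integral_indicator_const
          (μ := (η.boundedVariationOn t).vectorMeasure)
          (B := ContinuousLinearMap.apply ℝ E) c hs
        rw [ContinuousLinearMap.apply_apply] at this
        rw [← this]
        congr 1
      rw [this]
      exact (ContinuousLinearMap.apply ℝ E c).continuous.comp_stronglyMeasurable
        (η.stronglyMeasurable_vectorMeasure hs)
    | add hfg hf hg =>
      rename_i f g
      have : (fun t => VectorMeasure.integral (η.boundedVariationOn t).vectorMeasure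
          (f + g : SimpleFunc ℝ E) (ContinuousLinearMap.apply ℝ E)) = fun t =>
          VectorMeasure.integral (η.boundedVariationOn t).vectorMeasure f
            (ContinuousLinearMap.apply ℝ E) +
          VectorMeasure.integral (η.boundedVariationOn t).vectorMeasure g
            (ContinuousLinearMap.apply ℝ E) := by
        funext t
        rw [SimpleFunc.coe_add]
        exact VectorMeasure.integral_add (SimpleFunc.integrable_of_isFiniteMeasure f)
          (SimpleFunc.integrable_of_isFiniteMeasure g)
      rw [this]
      exact hf.add hg
  have hψ := stronglyMeasurable_extend ψ
  refine stronglyMeasurable_of_tendsto (f := fun (n : ℕ) t =>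
    VectorMeasure.integral (η.boundedVariationOn t).vectorMeasure (hψ.approxBounded ‖ψ‖ n)
      (ContinuousLinearMap.apply ℝ E)) atTop (fun n => hsimple _) (tendsto_pi_nhds.2 fun t => ?_)
  refine VectorMeasure.tendsto_integral_filter_of_norm_le_const
    (Eventually.of_forall fun n => (SimpleFunc.stronglyMeasurable _).aestronglyMeasurable)
    ⟨‖ψ‖, Eventually.of_forall fun n => Eventually.of_forall fun ω =>
      hψ.norm_approxBounded_le (norm_nonneg _) n ω⟩
    (Eventually.of_forall fun ω => hψ.tendsto_approxBounded_of_norm_le (norm_extend_le ψ ω))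

/-- `t ↦ L(t) z(t)` is measurable for every continuous curve `z` in the phase space. -/
theorem Kernel.stronglyMeasurable_LC_comp (η : Kernel r E) {z : ℝ → Phase r E}
    (hz : Continuous z) : StronglyMeasurable fun t => η.LC t (z t) := by
  let v : ℝ → ℝ → E := fun σ t => η.LC t (z σ)
  have h1 : ∀ t, Continuous fun σ => v σ t := fun t => (η.LC t).cont.comp hz
  have h2 : ∀ σ, StronglyMeasurable (v σ) := fun σ => η.stronglyMeasurable_LC (z σ)
  have h3 : StronglyMeasurable (Function.uncurry v) :=
    stronglyMeasurable_uncurry_of_continuous_of_stronglyMeasurable h1 h2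
  exact h3.comp_measurable (g := fun t : ℝ => (t, t)) (measurable_id.prodMk measurable_id)

end KernelOperator

/-! ### Locally integrable functions and absolute continuity on the line -/

theorem _root_.MeasureTheory.LocallyIntegrable.intervalIntegrable {F : Type*}
    [NormedAddCommGroup F] {f : ℝ → F} (hf : LocallyIntegrable f volume) (a b : ℝ) :
    IntervalIntegrable f volume a b :=
  intervalIntegrable_iff.mpr <|
    (hf.integrableOn_isCompact isCompact_uIcc).mono_set uIoc_subset_uIcc

/-- Absolute continuity is inherited by functions with smaller increments. -/
theorem absolutelyContinuousOnInterval_of_dist_le {X Y : Type*} [PseudoMetricSpace X]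
    [PseudoMetricSpace Y] {f : ℝ → X} {g : ℝ → Y} {a b : ℝ}
    (hg : AbsolutelyContinuousOnInterval g a b)
    (h : ∀ x ∈ uIcc a b, ∀ y ∈ uIcc a b, dist (f x) (f y) ≤ dist (g x) (g y)) :
    AbsolutelyContinuousOnInterval f a b := by
  rw [absolutelyContinuousOnInterval_iff] at hg ⊢
  intro ε hε
  obtain ⟨δ, hδ, H⟩ := hg ε hε
  refine ⟨δ, hδ, fun I hI hlen => lt_of_le_of_lt (Finset.sum_le_sum fun i hi => ?_) (H I hI hlen)⟩
  exact h _ (hI.1 i hi).1 _ (hI.1 i hi).2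

theorem absolutelyContinuousOnInterval_integral {F : Type*} [NormedAddCommGroup F]
    [NormedSpace ℝ F] {f : ℝ → F} (hf : LocallyIntegrable f volume) (a b c : ℝ)
    (hc : c ∈ uIcc a b) :
    AbsolutelyContinuousOnInterval (fun t => ∫ τ in c..t, f τ) a b := by
  have hfn : LocallyIntegrable (fun τ => ‖f τ‖) volume := fun x => (hf x).norm
  refine absolutelyContinuousOnInterval_of_dist_le
    ((hfn.intervalIntegrable a b).absolutelyContinuousOnInterval_intervalIntegral hc) ?_
  intro x _ y _
  rw [dist_comm, dist_comm (∫ τ in c..x, ‖f τ‖), dist_eq_norm, Real.dist_eq,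
    intervalIntegral.integral_interval_sub_left (hf.intervalIntegrable _ _)
      (hf.intervalIntegrable _ _), intervalIntegral.integral_interval_sub_left
      (hfn.intervalIntegrable _ _) (hfn.intervalIntegrable _ _)]
  exact intervalIntegral.norm_integral_le_abs_integral_norm

theorem integral_mono_right {ℓ : ℝ → ℝ} (hℓ : LocallyIntegrable ℓ volume) (h0 : ∀ t, 0 ≤ ℓ t)
    (s : ℝ) : Monotone fun t => ∫ τ in s..t, ℓ τ := by
  intro a b hab
  have : (∫ τ in s..b, ℓ τ) - ∫ τ in s..a, ℓ τ = ∫ τ in a..b, ℓ τ :=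
    intervalIntegral.integral_interval_sub_left (hℓ.intervalIntegrable _ _)
      (hℓ.intervalIntegrable _ _)
  have h2 : 0 ≤ ∫ τ in a..b, ℓ τ := intervalIntegral.integral_nonneg hab fun t _ => h0 t
  simp only
  linarith

/-- With `Λ(t) = ∫_s^t ℓ`, one has `∫_s^t ℓ e^{2Λ} ≤ (e^{2Λ(t)} - 1)/2`. -/
theorem integral_mul_exp_integral_le {ℓ : ℝ → ℝ} (hℓ : LocallyIntegrable ℓ volume)
    (h0 : ∀ t, 0 ≤ ℓ t) {s t : ℝ} (hst : s ≤ t) :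
    ∫ τ in s..t, ℓ τ * Real.exp (2 * ∫ σ in s..τ, ℓ σ) ≤
      (Real.exp (2 * ∫ σ in s..t, ℓ σ) - 1) / 2 := by
  set f : ℝ → ℝ := fun τ => Real.exp (2 * ∫ σ in s..τ, ℓ σ) with hf
  have hmono : Monotone f := fun a b hab => by
    have := integral_mono_right hℓ h0 s hab
    simp only at this
    exact Real.exp_le_exp.2 (by linarith)
  have h1 := (hmono.monotoneOn (uIcc s t)).intervalIntegral_deriv_mem_uIcc
  rw [uIcc_of_le (sub_nonneg.2 (hmono hst))] at h1
  have h2 : ∫ τ in s..t, deriv f τ = ∫ τ in s..t, 2 * (ℓ τ * f τ) := by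
    refine intervalIntegral.integral_congr_ae ?_
    filter_upwards [_root_.LocallyIntegrable.ae_hasDerivAt_integral hℓ] with τ hτ _
    rw [(((hτ s).const_mul 2).exp).deriv]
    simp only [hf]
    ring
  rw [h2, intervalIntegral.integral_const_mul] at h1
  have h3 : f s = 1 := by simp [hf]
  have h4 := h1.2
  rw [h3] at h4
  change ∫ τ in s..t, ℓ τ * f τ ≤ (f t - 1) / 2
  linarith

/-! ### Segments of curves, and Gronwall's inequality -/

section Segments

variable {r : ℝ} {E : Type u} [NormedAddCommGroup E]

/-- The segment of a continuous function on the line, as an element of the phase space. -/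
def seg (r : ℝ) (x : C(ℝ, E)) (t : ℝ) : Phase r E :=
  ⟨fun ω => x (t + ω), by fun_prop⟩

@[simp]
theorem seg_apply (x : C(ℝ, E)) (t : ℝ) (ω : Icc (-r) (0 : ℝ)) : seg r x t ω = x (t + ω) := rfl

theorem continuous_seg (x : C(ℝ, E)) : Continuous (seg r x) :=
  (ContinuousMap.curry (⟨fun p : ℝ × Icc (-r) (0 : ℝ) => x (p.1 + p.2), by fun_prop⟩ :
    C(ℝ × Icc (-r) (0 : ℝ), E))).continuous

theorem seg_sub (x y : C(ℝ, E)) (t : ℝ) : seg r (x - y) t = seg r x t - seg r y t := rfl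

theorem norm_le_norm_seg (hr : 0 ≤ r) (x : C(ℝ, E)) (t : ℝ) : ‖x t‖ ≤ ‖seg r x t‖ := by
  have := (seg r x t).norm_coe_le_norm ⟨0, by simp [hr]⟩
  simpa using this

theorem norm_seg_le {x : C(ℝ, E)} {t A : ℝ} (hA : 0 ≤ A) (h : ∀ σ ∈ Icc (t - r) t, ‖x σ‖ ≤ A) :
    ‖seg r x t‖ ≤ A := by
  rw [ContinuousMap.norm_le _ hA]
  intro ω
  have := ω.2.1
  have := ω.2.2
  exact h _ ⟨by linarith, by linarith⟩

/-- Gronwall's inequality for delay equations, with a crude constant. -/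
theorem norm_seg_le_of_integral_bound {ℓ : ℝ → ℝ} (hℓ : LocallyIntegrable ℓ volume)
    (h0 : ∀ t, 0 ≤ ℓ t) {x : C(ℝ, E)} {s b A : ℝ} (hA : 0 ≤ A)
    (hinit : ∀ t ∈ Icc (s - r) s, ‖x t‖ ≤ A)
    (hint : ∀ t ∈ Icc s b, ‖x t‖ ≤ A + ∫ τ in s..t, ℓ τ * ‖seg r x τ‖) {t : ℝ}
    (ht : t ∈ Icc s b) : ‖seg r x t‖ ≤ 2 * A * Real.exp (2 * ∫ τ in s..t, ℓ τ) := by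
  set Λ : ℝ → ℝ := fun t => ∫ τ in s..max s t, ℓ τ with hΛ
  have hΛc : Continuous Λ :=
    (intervalIntegral.continuous_primitive hℓ.intervalIntegrable s).comp
      (continuous_const.max continuous_id)
  have hΛm : Monotone Λ := fun a b hab => integral_mono_right hℓ h0 s (max_le_max le_rfl hab)
  have hΛ0 (t : ℝ) : 0 ≤ Λ t :=
    intervalIntegral.integral_nonneg (le_max_left _ _) fun t _ => h0 t
  have hΛs {t : ℝ} (ht : s ≤ t) : Λ t = ∫ τ in s..t, ℓ τ := by simp [hΛ, ht]
  rcases le_or_gt 0 r with hr | hr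
  swap
  · have : IsEmpty (Icc (-r) (0 : ℝ)) := ⟨fun ω => by linarith [ω.2.1, ω.2.2]⟩
    have : ‖seg r x t‖ ≤ 0 := by
      rw [ContinuousMap.norm_le _ le_rfl]
      exact fun ω => isEmptyElim ω
    exact this.trans (by positivity)
  have hsb : s ≤ b := ht.1.trans ht.2
  -- the supremum of the weighted norm is attained
  obtain ⟨c, hc, hmax⟩ := (isCompact_Icc (a := s - r) (b := b)).exists_isMaxOn
    ⟨s, by constructor <;> linarith⟩
    (f := fun t => Real.exp (-(2 * Λ t)) * ‖x t‖) (by fun_prop)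
  set W := Real.exp (-(2 * Λ c)) * ‖x c‖ with hW
  have hW0 : 0 ≤ W := by positivity
  have hxW (t : ℝ) (ht : t ∈ Icc (s - r) b) : ‖x t‖ ≤ W * Real.exp (2 * Λ t) := by
    have h1 : Real.exp (-(2 * Λ t)) * ‖x t‖ ≤ W := hmax ht
    calc ‖x t‖ = Real.exp (-(2 * Λ t)) * ‖x t‖ * Real.exp (2 * Λ t) := by
          rw [mul_right_comm, ← Real.exp_add]; simp
      _ ≤ _ := by gcongr
  have hsegW (t : ℝ) (ht : t ∈ Icc s b) : ‖seg r x t‖ ≤ W * Real.exp (2 * Λ t) := by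
    refine norm_seg_le (by positivity) fun σ hσ => (hxW σ ⟨?_, ?_⟩).trans ?_
    · linarith [hσ.1, ht.1]
    · exact hσ.2.trans ht.2
    · have := hΛm hσ.2
      gcongr
  have hWA : W ≤ A + W / 2 := by
    rcases le_or_gt c s with hcs | hcs
    · have : Real.exp (-(2 * Λ c)) ≤ 1 := Real.exp_le_one_iff.2 (by linarith [hΛ0 c])
      calc W ≤ 1 * A := by
            rw [hW]
            gcongr
            exact hinit c ⟨hc.1, hcs⟩
        _ ≤ _ := by linarith
    · have h1 : ∫ τ in s..c, ℓ τ * ‖seg r x τ‖ ≤ W * ((Real.exp (2 * Λ c) - 1) / 2) := by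
        calc ∫ τ in s..c, ℓ τ * ‖seg r x τ‖
            ≤ ∫ τ in s..c, W * (ℓ τ * Real.exp (2 * ∫ σ in s..τ, ℓ σ)) := by
              refine intervalIntegral.integral_mono_on hcs.le ?_ ?_ ?_
              · exact (hℓ.intervalIntegrable _ _).mul_continuousOn
                  (continuous_seg x).norm.continuousOn
              · refine ((hℓ.intervalIntegrable _ _).mul_continuousOn ?_).const_mul W
                have := intervalIntegral.continuous_primitive hℓ.intervalIntegrable s
                exact (by fun_prop : Continuous fun τ =>
                  Real.exp (2 * ∫ σ in s..τ, ℓ σ)).continuousOn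
              · intro τ hτ
                have h2 := hsegW τ ⟨hτ.1, hτ.2.trans hc.2⟩
                rw [hΛs hτ.1] at h2
                calc ℓ τ * ‖seg r x τ‖ ≤ ℓ τ * (W * Real.exp (2 * ∫ σ in s..τ, ℓ σ)) :=
                      mul_le_mul_of_nonneg_left h2 (h0 τ)
                  _ = _ := by ring
          _ = W * ∫ τ in s..c, ℓ τ * Real.exp (2 * ∫ σ in s..τ, ℓ σ) :=
              intervalIntegral.integral_const_mul _ _
          _ ≤ _ := by
              rw [hΛs hcs.le]
              exact mul_le_mul_of_nonneg_left (integral_mul_exp_integral_le hℓ h0 hcs.le) hW0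
      have h2 := hint c ⟨hcs.le, hc.2⟩
      have h3 : Real.exp (-(2 * Λ c)) ≤ 1 := Real.exp_le_one_iff.2 (by linarith [hΛ0 c])
      calc W ≤ Real.exp (-(2 * Λ c)) * (A + W * ((Real.exp (2 * Λ c) - 1) / 2)) := by
            rw [hW]
            gcongr
            exact h2.trans (by linarith)
        _ = Real.exp (-(2 * Λ c)) * A + W / 2 * (Real.exp (-(2 * Λ c)) * Real.exp (2 * Λ c))
            - Real.exp (-(2 * Λ c)) * W / 2 := by ring
        _ ≤ 1 * A + W / 2 * 1 - 0 := by
            rw [← Real.exp_add, neg_add_cancel, Real.exp_zero]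
            gcongr
            positivity
        _ = _ := by ring
  have := hsegW t ht
  rw [hΛs ht.1] at this
  refine this.trans ?_
  gcongr
  linarith

end Segments

/-! ### Carathéodory vector fields -/

section Flow

variable {r : ℝ} {E : Type u} [NormedAddCommGroup E] [NormedSpace ℝ E]

/-- A Carathéodory vector field on the phase space: measurable along continuous curves, with a
locally integrable Lipschitz constant `ℓ(t)` that also bounds its value at zero. -/
structure IsField (F : ℝ → Phase r E → E) (ℓ : ℝ → ℝ) : Prop where
  locallyIntegrable : LocallyIntegrable ℓ volume
  nonneg : ∀ t, 0 ≤ ℓ t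
  measurable : ∀ z : ℝ → Phase r E, Continuous z → AEStronglyMeasurable (fun t => F t (z t)) volume
  lipschitz : ∀ t φ ψ, ‖F t φ - F t ψ‖ ≤ ℓ t * ‖φ - ψ‖
  norm_zero_le : ∀ t, ‖F t 0‖ ≤ ℓ t

/-- `x` is a solution on `[s-r, ∞)` of the integral equation `x(t) = x(s) + ∫_s^t F(τ, x_τ) dτ`. -/
def IsMild (F : ℝ → Phase r E → E) (s : ℝ) (x : C(ℝ, E)) : Prop :=
  ∀ t, s ≤ t → x t = x s + ∫ τ in s..t, F τ (seg r x τ)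

variable {F G : ℝ → Phase r E → E} {ℓ ℓ' : ℝ → ℝ}

omit [NormedSpace ℝ E] in
theorem IsField.norm_le (hF : IsField F ℓ) (t : ℝ) (φ : Phase r E) :
    ‖F t φ‖ ≤ ℓ t * (1 + ‖φ‖) := by
  calc ‖F t φ‖ = ‖F t 0 + (F t φ - F t 0)‖ := by congr 1; abel
    _ ≤ ℓ t + ℓ t * ‖φ - 0‖ := (norm_add_le _ _).trans (add_le_add (hF.norm_zero_le t)
        (hF.lipschitz t φ 0))
    _ = _ := by rw [sub_zero]; ring

omit [NormedSpace ℝ E] in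
theorem IsField.locallyIntegrable_comp (hF : IsField F ℓ) {z : ℝ → Phase r E}
    (hz : Continuous z) : LocallyIntegrable (fun t => F t (z t)) volume := by
  have h1 : LocallyIntegrable (fun t => ℓ t * (1 + ‖z t‖)) volume :=
    hF.locallyIntegrable.mul_continuous (continuous_const.add hz.norm)
  refine h1.mono (hF.measurable z hz) (Eventually.of_forall fun t => ?_)
  refine (hF.norm_le t (z t)).trans (le_abs_self _)

theorem IsMild.mono {s c : ℝ} {x : C(ℝ, E)} (hF : IsField F ℓ) (hx : IsMild F s x) (hsc : s ≤ c) :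
    IsMild F c x := by
  intro t ht
  have hi := hF.locallyIntegrable_comp (continuous_seg x)
  rw [hx t (hsc.trans ht), hx c hsc, add_assoc, intervalIntegral.integral_add_adjacent_intervals
    (hi.intervalIntegrable _ _) (hi.intervalIntegrable _ _)]

/-- Lipschitz dependence of solutions on the initial segment. -/
theorem IsMild.norm_seg_sub_le {s t : ℝ} {x y : C(ℝ, E)} (hr : 0 ≤ r) (hF : IsField F ℓ)
    (hx : IsMild F s x) (hy : IsMild F s y) (hst : s ≤ t) :
    ‖seg r x t - seg r y t‖ ≤
      2 * ‖seg r x s - seg r y s‖ * Real.exp (2 * ∫ τ in s..t, ℓ τ) := by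
  rw [← seg_sub, ← seg_sub]
  have hi := hF.locallyIntegrable_comp (continuous_seg (r := r) x)
  have hj := hF.locallyIntegrable_comp (continuous_seg (r := r) y)
  refine norm_seg_le_of_integral_bound hF.locallyIntegrable hF.nonneg (norm_nonneg _) ?_ ?_
    ⟨hst, le_rfl⟩
  · intro σ hσ
    have := (seg r (x - y) s).norm_coe_le_norm ⟨σ - s, by linarith [hσ.1], by linarith [hσ.2]⟩
    simpa using this
  · intro σ hσ
    have h1 : (x - y) σ = (x - y) s + ∫ τ in s..σ, (F τ (seg r x τ) - F τ (seg r y τ)) := by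
      rw [intervalIntegral.integral_sub (hi.intervalIntegrable _ _) (hj.intervalIntegrable _ _)]
      simp only [ContinuousMap.sub_apply]
      rw [hx σ hσ.1, hy σ hσ.1]
      abel
    rw [h1]
    refine (norm_add_le _ _).trans (add_le_add (norm_le_norm_seg hr _ _) ?_)
    refine intervalIntegral.norm_integral_le_of_norm_le hσ.1 ?_
      ((hF.locallyIntegrable.intervalIntegrable _ _).mul_continuousOn
        (continuous_seg (x - y)).norm.continuousOn)
    exact Eventually.of_forall fun τ _ => hF.lipschitz τ _ _

end Flow

/-! ### Solution operators -/

section Flow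

variable {r : ℝ} {E : Type u} [NormedAddCommGroup E] [NormedSpace ℝ E]
variable {F G : ℝ → Phase r E → E} {ℓ ℓ' : ℝ → ℝ}

/-- Global existence of solutions: the Picard operator is a contraction for the weighted norm
`sup e^{-2Λ(t)} ‖x(t)‖` with `Λ(t) = ∫_s^t ℓ`. -/
theorem IsField.exists_isMild [CompleteSpace E] (hr : 0 ≤ r) (hF : IsField F ℓ) (s : ℝ)
    (φ : Phase r E) : ∃ x : C(ℝ, E), seg r x s = φ ∧ IsMild F s x := by
  have hr' : -r ≤ 0 := by linarith
  have hℓ := hF.locallyIntegrable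
  set Λ : ℝ → ℝ := fun t => ∫ τ in s..max s t, ℓ τ with hΛ
  have hΛc : Continuous Λ :=
    (intervalIntegral.continuous_primitive hℓ.intervalIntegrable s).comp
      (continuous_const.max continuous_id)
  have hΛm : Monotone Λ := fun a b hab =>
    integral_mono_right hℓ hF.nonneg s (max_le_max le_rfl hab)
  have hΛ0 (t : ℝ) : 0 ≤ Λ t :=
    intervalIntegral.integral_nonneg (le_max_left _ _) fun t _ => hF.nonneg t
  have hΛs {t : ℝ} (ht : s ≤ t) : Λ t = ∫ τ in s..t, ℓ τ := by simp [hΛ, ht]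
  set w : ℝ → ℝ := fun t => Real.exp (2 * Λ t) with hw
  have hwc : Continuous w := by fun_prop
  have hwm : Monotone w := fun a b hab => Real.exp_le_exp.2 (by linarith [hΛm hab])
  have hw1 (t : ℝ) : 1 ≤ w t := Real.one_le_exp (by linarith [hΛ0 t])
  have hw0 (t : ℝ) : 0 < w t := Real.exp_pos _
  have hwi (t : ℝ) : ∫ τ in s..max s t, ℓ τ * w τ ≤ (w t - 1) / 2 := by
    have h1 := integral_mul_exp_integral_le hℓ hF.nonneg (le_max_left s t)
    refine le_trans (le_of_eq ?_) h1
    refine intervalIntegral.integral_congr fun τ hτ => ?_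
    rw [uIcc_of_le (le_max_left _ _)] at hτ
    simp only [hw, hΛs hτ.1]
  have hwl (a b : ℝ) : IntervalIntegrable (fun τ => ℓ τ * w τ) volume a b :=
    (hℓ.intervalIntegrable a b).mul_continuousOn hwc.continuousOn
  let ev : BoundedContinuousFunction ℝ E → C(ℝ, E) := fun v =>
    ⟨fun t => w t • v t, hwc.smul v.continuous⟩
  have hev (v : BoundedContinuousFunction ℝ E) (t : ℝ) : ‖seg r (ev v) t‖ ≤ ‖v‖ * w t := by
    refine norm_seg_le (mul_nonneg (norm_nonneg _) (hw0 t).le) fun σ hσ => ?_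
    change ‖w σ • v σ‖ ≤ _
    rw [norm_smul, Real.norm_of_nonneg (hw0 σ).le, mul_comm]
    have := hwm hσ.2
    gcongr
    · exact v.norm_coe_le_norm σ
  have hli (v : BoundedContinuousFunction ℝ E) :
      LocallyIntegrable (fun τ => F τ (seg r (ev v) τ)) volume :=
    hF.locallyIntegrable_comp (continuous_seg (ev v))
  let φ' : ℝ → E := fun t => IccExtend hr' φ (t - s)
  have hφc : Continuous φ' := (φ.continuous.Icc_extend' (h := hr')).comp (by fun_prop)
  let J : BoundedContinuousFunction ℝ E → ℝ → E := fun v t =>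
    ∫ τ in s..max s t, F τ (seg r (ev v) τ)
  have hJc (v : BoundedContinuousFunction ℝ E) : Continuous (J v) :=
    (intervalIntegral.continuous_primitive (hli v).intervalIntegrable s).comp
      (continuous_const.max continuous_id)
  have hJb (v : BoundedContinuousFunction ℝ E) (t : ℝ) :
      ‖J v t‖ ≤ (1 + ‖v‖) * (w t) := by
    have h1 : ‖J v t‖ ≤ ∫ τ in s..max s t, (1 + ‖v‖) * (ℓ τ * w τ) := by
      refine intervalIntegral.norm_integral_le_of_norm_le (le_max_left _ _) ?_
        ((hwl _ _).const_mul _)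
      refine Eventually.of_forall fun τ _ => ?_
      calc ‖F τ (seg r (ev v) τ)‖ ≤ ℓ τ * (1 + ‖seg r (ev v) τ‖) := hF.norm_le _ _
        _ ≤ ℓ τ * (1 * w τ + ‖v‖ * w τ) := by
            have := hF.nonneg τ
            have := hev v τ
            have := hw1 τ
            gcongr
            linarith
        _ = _ := by ring
    rw [intervalIntegral.integral_const_mul] at h1
    refine h1.trans ?_
    have := hwi t
    have := hw0 t
    gcongr
    linarith
  let Φ : BoundedContinuousFunction ℝ E → BoundedContinuousFunction ℝ E := fun v =>
    BoundedContinuousFunction.ofNormedAddCommGroup (fun t => (w t)⁻¹ • (φ' t + J v t))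
      ((hwc.inv₀ fun t => (hw0 t).ne').smul (hφc.add (hJc v))) (‖φ‖ + (1 + ‖v‖)) (by
        intro t
        rw [norm_smul, norm_inv, Real.norm_of_nonneg (hw0 t).le]
        rw [inv_mul_le_iff₀ (hw0 t)]
        have h1 : ‖φ' t‖ ≤ ‖φ‖ := φ.norm_coe_le_norm _
        have h2 := hJb v t
        have h3 : ‖φ‖ ≤ w t * ‖φ‖ := le_mul_of_one_le_left (norm_nonneg _) (hw1 t)
        refine (norm_add_le _ _).trans ?_
        linarith)
  have hΦ : ContractingWith (1 / 2) Φ := by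
    refine ⟨by norm_num, LipschitzWith.of_dist_le_mul fun v v' => ?_⟩
    rw [BoundedContinuousFunction.dist_le (by positivity)]
    intro t
    have h1 : ‖J v t - J v' t‖ ≤ ∫ τ in s..max s t, ‖v - v'‖ * (ℓ τ * w τ) := by
      simp only [J]
      rw [← intervalIntegral.integral_sub ((hli v).intervalIntegrable _ _)
        ((hli v').intervalIntegrable _ _)]
      refine intervalIntegral.norm_integral_le_of_norm_le (le_max_left _ _) ?_
        ((hwl _ _).const_mul _)
      refine Eventually.of_forall fun τ _ => (hF.lipschitz _ _ _).trans ?_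
      have h2 : seg r (ev v) τ - seg r (ev v') τ = seg r (ev (v - v')) τ := by
        ext ω
        simp [ev, smul_sub]
      rw [h2]
      calc ℓ τ * ‖seg r (ev (v - v')) τ‖ ≤ ℓ τ * (‖v - v'‖ * w τ) :=
            mul_le_mul_of_nonneg_left (hev _ _) (hF.nonneg τ)
        _ = _ := by ring
    rw [intervalIntegral.integral_const_mul] at h1
    have h3 : dist (Φ v t) (Φ v' t) = (w t)⁻¹ * ‖J v t - J v' t‖ := by
      change dist ((w t)⁻¹ • (φ' t + J v t)) ((w t)⁻¹ • (φ' t + J v' t)) = _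
      rw [dist_smul₀, dist_add_left, dist_eq_norm, norm_inv, Real.norm_of_nonneg (hw0 t).le]
    rw [h3, inv_mul_le_iff₀ (hw0 t), dist_eq_norm]
    refine h1.trans ?_
    calc ‖v - v'‖ * ∫ τ in s..max s t, ℓ τ * w τ ≤ ‖v - v'‖ * ((w t - 1) / 2) :=
          mul_le_mul_of_nonneg_left (hwi t) (norm_nonneg _)
      _ ≤ ‖v - v'‖ * (w t / 2) := by
          gcongr
          linarith
      _ = _ := by
          push_cast
          ring
  set v := hΦ.fixedPoint Φ with hv
  have hfix : Φ v = v := hΦ.fixedPoint_isFixedPt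
  have hx (t : ℝ) : ev v t = φ' t + J v t := by
    have h1 : (w t)⁻¹ • (φ' t + J v t) = v t := congrArg (fun f => f t) hfix
    change w t • v t = _
    rw [← h1, smul_inv_smul₀ (hw0 t).ne']
  have hφ' {t : ℝ} (ht : s ≤ t) : φ' t = φ ⟨0, by simp [hr]⟩ :=
    IccExtend_of_right_le _ _ (by linarith)
  refine ⟨ev v, ?_, ?_⟩
  · ext ω
    have hω : s + (ω : ℝ) ≤ s := by linarith [ω.2.2]
    rw [seg_apply, hx]
    simp [J, hω, φ']
  · intro t ht
    rw [hx, hx, hφ' ht, hφ' le_rfl]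
    simp [J, ht]

open Classical in
/-- The solution operators `φ ↦ x_t`, `x_s = φ`, of `x'(t) = F(t, x_t)`, for `t ≥ s` (zero if
there is no solution). -/
def flow (F : ℝ → Phase r E → E) (t s : ℝ) (φ : Phase r E) : Phase r E :=
  if h : ∃ x : C(ℝ, E), seg r x s = φ ∧ IsMild F s x then seg r h.choose t else 0

theorem IsField.flow_seg (hr : 0 ≤ r) (hF : IsField F ℓ) {s t : ℝ} (hst : s ≤ t) {x : C(ℝ, E)}
    (hx : IsMild F s x) : flow F t s (seg r x s) = seg r x t := by
  have h : ∃ y : C(ℝ, E), seg r y s = seg r x s ∧ IsMild F s y := ⟨x, rfl, hx⟩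
  rw [flow, dif_pos h]
  obtain ⟨h1, h2⟩ := h.choose_spec
  have := h2.norm_seg_sub_le hr hF hx hst
  rw [h1, sub_self, norm_zero, mul_zero, zero_mul, norm_le_zero_iff, sub_eq_zero] at this
  exact this

variable [CompleteSpace E]

theorem IsField.exists_flow_eq (hr : 0 ≤ r) (hF : IsField F ℓ) (s : ℝ) (φ : Phase r E) :
    ∃ x : C(ℝ, E), seg r x s = φ ∧ IsMild F s x ∧ ∀ t, s ≤ t → flow F t s φ = seg r x t := by
  obtain ⟨x, rfl, hx⟩ := hF.exists_isMild hr s φ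
  exact ⟨x, rfl, hx, fun t ht => hF.flow_seg hr ht hx⟩

theorem IsField.flow_self (hr : 0 ≤ r) (hF : IsField F ℓ) (s : ℝ) (φ : Phase r E) :
    flow F s s φ = φ := by
  obtain ⟨x, hx, -, h⟩ := hF.exists_flow_eq hr s φ
  rw [h s le_rfl, hx]

theorem IsField.flow_flow (hr : 0 ≤ r) (hF : IsField F ℓ) {s c t : ℝ} (hsc : s ≤ c) (hct : c ≤ t)
    (φ : Phase r E) : flow F t c (flow F c s φ) = flow F t s φ := by
  obtain ⟨x, -, hx, h⟩ := hF.exists_flow_eq hr s φ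
  rw [h c hsc, h t (hsc.trans hct), hF.flow_seg hr hct (hx.mono hF hsc)]

theorem IsField.norm_flow_sub_le (hr : 0 ≤ r) (hF : IsField F ℓ) {s t : ℝ} (hst : s ≤ t)
    (φ ψ : Phase r E) : ‖flow F t s φ - flow F t s ψ‖ ≤
      2 * ‖φ - ψ‖ * Real.exp (2 * ∫ τ in s..t, ℓ τ) := by
  obtain ⟨x, hxs, hx, h⟩ := hF.exists_flow_eq hr s φ
  obtain ⟨y, hys, hy, h'⟩ := hF.exists_flow_eq hr s ψ
  rw [h t hst, h' t hst, ← hxs, ← hys]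
  exact hx.norm_seg_sub_le hr hF hy hst

theorem IsField.continuousOn_flow (hr : 0 ≤ r) (hF : IsField F ℓ) (s : ℝ) (φ : Phase r E) :
    ContinuousOn (fun t => flow F t s φ) (Ici s) := by
  obtain ⟨x, -, -, h⟩ := hF.exists_flow_eq hr s φ
  exact (continuous_seg x).continuousOn.congr fun t ht => h t ht

/-- The solution operators are jointly continuous in time and initial segment. -/
theorem IsField.tendsto_flow (hr : 0 ≤ r) (hF : IsField F ℓ) {s t₀ : ℝ} (hst : s < t₀)
    {φ₀ : Phase r E} {X : Type*} {l : Filter X} {τ : X → ℝ} {φ : X → Phase r E}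
    (hτ : Tendsto τ l (𝓝 t₀)) (hφ : Tendsto φ l (𝓝 φ₀)) :
    Tendsto (fun p => flow F (τ p) s (φ p)) l (𝓝 (flow F t₀ s φ₀)) := by
  have h1 : Tendsto (fun p => flow F (τ p) s φ₀) l (𝓝 (flow F t₀ s φ₀)) :=
    ((hF.continuousOn_flow hr s φ₀).continuousAt (Ici_mem_nhds hst)).tendsto.comp hτ
  have h2 : Tendsto (fun p => flow F (τ p) s (φ p) - flow F (τ p) s φ₀) l (𝓝 0) := by
    have h3 : Tendsto (fun p => 2 * ‖φ p - φ₀‖ * Real.exp (2 * ∫ σ in s..τ p, ℓ σ)) l (𝓝 0) := by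
      have h4 : Tendsto (fun p => ‖φ p - φ₀‖) l (𝓝 0) := by
        simpa using (hφ.sub_const φ₀).norm
      have h5 : Continuous fun t => Real.exp (2 * ∫ σ in s..t, ℓ σ) := by
        have := intervalIntegral.continuous_primitive hF.locallyIntegrable.intervalIntegrable s
        fun_prop
      simpa using (h4.const_mul 2).mul ((h5.tendsto t₀).comp hτ)
    refine squeeze_zero_norm' ?_ h3
    filter_upwards [hτ.eventually (lt_mem_nhds hst)] with p hp
    exact hF.norm_flow_sub_le hr hp.le _ _
  simpa using h2.add h1

theorem IsField.continuous_flow (hr : 0 ≤ r) (hF : IsField F ℓ) {s t : ℝ} (hst : s ≤ t) :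
    Continuous (flow F t s) := by
  refine continuous_iff_continuousAt.2 fun φ₀ => ?_
  have h3 : Tendsto (fun φ => 2 * ‖φ - φ₀‖ * Real.exp (2 * ∫ σ in s..t, ℓ σ)) (𝓝 φ₀) (𝓝 0) := by
    have : Continuous fun φ : Phase r E => 2 * ‖φ - φ₀‖ * Real.exp (2 * ∫ σ in s..t, ℓ σ) := by
      fun_prop
    simpa using this.tendsto φ₀
  have h2 : Tendsto (fun φ => flow F t s φ - flow F t s φ₀) (𝓝 φ₀) (𝓝 0) :=
    squeeze_zero_norm (fun φ => hF.norm_flow_sub_le hr hst _ _) h3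
  simpa [ContinuousAt] using h2.add_const (flow F t s φ₀)

/-- Two vector fields that agree along a trajectory of the first have it in common. -/
theorem IsField.flow_congr (hr : 0 ≤ r) (hF : IsField F ℓ) (hG : IsField G ℓ') {s t : ℝ}
    (hst : s ≤ t) {φ : Phase r E} (h : ∀ τ, s ≤ τ → F τ (flow F τ s φ) = G τ (flow F τ s φ)) :
    flow F t s φ = flow G t s φ := by
  obtain ⟨x, hxs, hx, h'⟩ := hF.exists_flow_eq hr s φ
  have hx' : IsMild G s x := by
    intro σ hσ
    rw [hx σ hσ]
    congr 1
    refine intervalIntegral.integral_congr fun τ hτ => ?_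
    rw [uIcc_of_le hσ] at hτ
    have := h τ hτ.1
    rwa [h' τ hτ.1] at this
  rw [h' t hst, ← hG.flow_seg hr hst hx', hxs]

/-! ### Absolutely continuous solutions and solutions of the integral equation -/

/-- Solutions of the integral equation solve the delay equation, by Lebesgue differentiation. -/
theorem IsMild.isSolution (hF : IsField F ℓ) {F' : ℝ → (Icc (-r) (0 : ℝ) → E) → E}
    (hF' : ∀ t (ψ : Phase r E), F' t ψ = F t ψ) {s : ℝ} {x : C(ℝ, E)} (hx : IsMild F s x) :
    IsSolution F' s (seg r x s) x where
  initial := rfl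
  absolutelyContinuous b hb := by
    have hi := hF.locallyIntegrable_comp (continuous_seg x)
    refine absolutelyContinuousOnInterval_of_dist_le
      (absolutelyContinuousOnInterval_integral hi s b s left_mem_uIcc) fun t ht t' ht' => ?_
    rw [uIcc_of_le hb] at ht ht'
    rw [hx t ht.1, hx t' ht'.1, dist_add_left]
  equation := by
    have hi := hF.locallyIntegrable_comp (continuous_seg x)
    have hne : ∀ᵐ t ∂(volume : Measure ℝ), t ≠ s := by simp [ae_iff, measure_singleton]
    filter_upwards [_root_.LocallyIntegrable.ae_hasDerivAt_integral hi, hne] with t ht hts hst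
    have h1 := (ht s).const_add (x s)
    have h2 : F' t (segment r x t) = F t (seg r x t) := hF' t (seg r x t)
    rw [h2]
    refine h1.congr_of_eventuallyEq ?_
    filter_upwards [lt_mem_nhds (lt_of_le_of_ne hst hts.symm)] with σ hσ using hx σ hσ.le

/-- Solutions of the delay equation solve the integral equation: the difference of the two sides
is absolutely continuous with derivative zero almost everywhere. -/
theorem IsSolution.exists_isMild (hr : 0 ≤ r) (hF : IsField F ℓ)
    {F' : ℝ → (Icc (-r) (0 : ℝ) → E) → E} (hF' : ∀ t (ψ : Phase r E), F' t ψ = F t ψ) {s : ℝ}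
    {φ : Phase r E} {x : ℝ → E} (hx : IsSolution F' s φ x) :
    ∃ y : C(ℝ, E), seg r y s = φ ∧ IsMild F s y ∧ ∀ t, s ≤ t → segment r x t = seg r y t := by
  have hr' : -r ≤ 0 := by linarith
  have hxs : x s = φ ⟨0, by simp [hr]⟩ := by
    have := congrFun hx.initial ⟨0, by simp [hr]⟩
    simpa [segment] using this
  have hcont : ContinuousOn x (Ici s) := by
    intro t ht
    have h1 := (hx.absolutelyContinuous (t + 1) (by linarith [mem_Ici.1 ht])).continuousOn
    rw [uIcc_of_le (by linarith [mem_Ici.1 ht])] at h1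
    refine (h1 t ⟨ht, by linarith⟩).mono_of_mem_nhdsWithin ?_
    filter_upwards [self_mem_nhdsWithin, mem_nhdsWithin_of_mem_nhds (gt_mem_nhds (lt_add_one t))]
      with σ h1 h2 using ⟨h1, h2.le⟩
  -- the solution, continued to the left of `s - r` by a constant
  let y : C(ℝ, E) := ⟨fun t => IccExtend hr' φ (t - s) + x (max s t) - x s, by
    have h1 : Continuous fun t => x (max s t) :=
      hcont.comp_continuous (continuous_const.max continuous_id) fun t =>
        mem_Ici.2 (le_max_left s t)
    have h2 : Continuous fun t => IccExtend hr' φ (t - s) :=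
      (φ.continuous.Icc_extend' (h := hr')).comp (by fun_prop)
    exact (h2.add h1).sub continuous_const⟩
  have hy1 {t : ℝ} (ht : s ≤ t) : y t = x t := by
    change IccExtend hr' φ (t - s) + x (max s t) - x s = x t
    rw [IccExtend_of_right_le hr' φ (by linarith), max_eq_right ht, hxs]
    abel
  have hy2 {t : ℝ} (ht : t ∈ Icc (s - r) s) : y t = x t := by
    change IccExtend hr' φ (t - s) + x (max s t) - x s = x t
    have hm : t - s ∈ Icc (-r) (0 : ℝ) := ⟨by linarith [ht.1], by linarith [ht.2]⟩
    rw [IccExtend_of_mem hr' φ hm, max_eq_left ht.2, ← hx.initial]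
    simp [segment]
  have hseg {t : ℝ} (ht : s ≤ t) : segment r x t = seg r y t := by
    funext ω
    have := ω.2.1
    rcases le_total s (t + ω) with h | h
    · exact (hy1 h).symm
    · exact (hy2 ⟨by linarith, h⟩).symm
  refine ⟨y, ?_, ?_, fun t ht => hseg ht⟩
  · refine DFunLike.coe_injective ?_
    rw [← hseg le_rfl, hx.initial]
  · intro t ht
    have hi := hF.locallyIntegrable_comp (continuous_seg (r := r) y)
    set z : ℝ → E := fun t => x t - ∫ τ in s..t, F τ (seg r y τ) with hz
    have hac : AbsolutelyContinuousOnInterval z s t :=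
      (hx.absolutelyContinuous t ht).sub
        (absolutelyContinuousOnInterval_integral hi s t s left_mem_uIcc)
    have hder : ∀ᵐ σ, σ ∈ uIcc s t → HasDerivAt z 0 σ := by
      filter_upwards [_root_.LocallyIntegrable.ae_hasDerivAt_integral hi, hx.equation]
        with σ h1 h2 hσ
      rw [uIcc_of_le ht] at hσ
      have h3 : F' σ (segment r x σ) = F σ (seg r y σ) := by rw [hseg hσ.1, hF']
      have h4 := (h2 hσ.1).sub (h1 s)
      rwa [h3, sub_self] at h4
    obtain ⟨C, hC⟩ := hac.const_of_ae_hasDerivAt_zero hder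
    have h1 := (hC t right_mem_uIcc).trans (hC s left_mem_uIcc).symm
    simp only [hz, intervalIntegral.integral_same, sub_zero] at h1
    rw [hy1 ht, hy1 le_rfl, ← h1]
    abel

theorem evolution_eq_flow (hr : 0 ≤ r) (hF : IsField F ℓ)
    {F' : ℝ → (Icc (-r) (0 : ℝ) → E) → E} (hF' : ∀ t (ψ : Phase r E), F' t ψ = F t ψ) {s t : ℝ}
    (hst : s ≤ t) (φ : Phase r E) : evolution F' t s φ = flow F t s φ := by
  have h : ∃ x, IsSolution F' s φ x := by
    obtain ⟨x, rfl, hx⟩ := hF.exists_isMild hr s φ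
    exact ⟨x, hx.isSolution hF hF'⟩
  rw [evolution, dif_pos h]
  obtain ⟨y, rfl, hy, h'⟩ := h.choose_spec.exists_isMild hr hF hF'
  rw [h' t hst, hF.flow_seg hr hst hy]

omit [NormedSpace ℝ E] [CompleteSpace E] in
theorem toPhase_coe (φ : Phase r E) : toPhase (⇑φ) = φ := by
  rw [toPhase, dif_pos φ.continuous]
  rfl

end Flow

/-! ### Bounded solutions of inhomogeneous equations with a dichotomy -/

section Perron

variable {X : Type u} [NormedAddCommGroup X] [NormedSpace ℝ X]

/-- Backward induction on the half-line `(-∞, b]` by steps of length at most `r`. -/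
theorem backward_step_induction {p : ℝ → Prop} {r b : ℝ} (hr : 0 < r) (hb : p b)
    (step : ∀ s c, s ≤ c → c ≤ s + r → c ≤ b → p c → p s) {s : ℝ} (hs : s ≤ b) : p s := by
  have key (n : ℕ) : ∀ s, s ≤ b → b - s ≤ n * r → p s := by
    induction n with
    | zero =>
      intro s hs h
      have : s = b := le_antisymm hs (by simpa using h)
      rwa [this]
    | succ n ih =>
      intro s hs h
      push_cast at h
      refine step s (min (s + r) b) (le_min (by linarith) hs) (min_le_left _ _) (min_le_right _ _)
        (ih _ (min_le_right _ _) ?_)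
      rcases min_choice (s + r) b with h' | h' <;> rw [h']
      · linarith
      · have : (0 : ℝ) ≤ n * r := by positivity
        linarith
  obtain ⟨n, hn⟩ := exists_nat_ge ((b - s) / r)
  exact key n s hs ((div_le_iff₀ hr).1 hn)

omit [NormedSpace ℝ X] in
/-- A curve whose increments beyond `s` are at most `b(s) → 0` has a limit, with error `b(s)`. -/
theorem exists_limit_of_norm_sub_le [CompleteSpace X] {x : ℝ → X} {b : ℝ → ℝ} {t : ℝ}
    (hb : Tendsto b atTop (𝓝 0)) (h : ∀ s s', t ≤ s → s ≤ s' → ‖x s' - x s‖ ≤ b s) :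
    ∃ S, ∀ s, t ≤ s → ‖S - x s‖ ≤ b s := by
  have hseq : Tendsto (fun n : ℕ => t + n) atTop atTop :=
    tendsto_atTop_add_const_left _ _ tendsto_natCast_atTop_atTop
  have hc : CauchySeq fun n : ℕ => x (t + n) := by
    refine cauchySeq_of_le_tendsto_0' (fun n : ℕ => b (t + n)) (fun n m hnm => ?_) (hb.comp hseq)
    rw [dist_comm, dist_eq_norm]
    refine h _ _ (by linarith [n.cast_nonneg (α := ℝ)]) ?_
    have : (n : ℝ) ≤ m := by exact_mod_cast hnm
    linarith
  obtain ⟨S, hS⟩ := cauchySeq_tendsto_of_complete hc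
  refine ⟨S, fun s hs => le_of_tendsto (hS.sub_const (x s)).norm ?_⟩
  filter_upwards [hseq.eventually_ge_atTop s] with n hn using h s _ hs hn

/-- An evolution family of continuous additive maps. -/
structure IsEvolution (T : ℝ → ℝ → X → X) : Prop where
  self : ∀ s φ, T s s φ = φ
  comp : ∀ {s c t}, s ≤ c → c ≤ t → ∀ φ, T t c (T c s φ) = T t s φ
  sub : ∀ {s t}, s ≤ t → ∀ φ ψ, T t s (φ - ψ) = T t s φ - T t s ψ
  cont : ∀ {s t}, s ≤ t → Continuous (T t s)

omit [NormedSpace ℝ X] in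
theorem IsEvolution.zero {T : ℝ → ℝ → X → X} (hT : IsEvolution T) {s t : ℝ} (hst : s ≤ t) :
    T t s 0 = 0 := by
  have := hT.sub hst 0 0
  rwa [sub_self, sub_self] at this

omit [NormedSpace ℝ X] in
theorem IsEvolution.add {T : ℝ → ℝ → X → X} (hT : IsEvolution T) {s t : ℝ} (hst : s ≤ t)
    (φ ψ : X) : T t s (φ + ψ) = T t s φ + T t s ψ := by
  have h := hT.sub hst φ (0 - ψ)
  rw [hT.sub hst 0 ψ, hT.zero hst] at h
  simpa using h

/-- A dichotomy of the evolution family `T` with projections `P(s)`, in terms of `u = log μ`.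
The unstable space at time `s` is the kernel of `P(s)`; the last condition bounds the inverse of
`T(t,s)` on unstable spaces, composed with `I - P(t)`. -/
structure IsLogDichotomy (T : ℝ → ℝ → X → X) (P : ℝ → X →L[ℝ] X) (u : ℝ → ℝ)
    (K α β θ ν : ℝ) : Prop where
  proj : ∀ s φ, P s (P s φ) = P s φ
  invariant : ∀ {s t}, s ≤ t → ∀ φ, T t s (P s φ) = P t (T t s φ)
  surj : ∀ {s t}, s ≤ t → ∀ φ, ∃ b, P s b = 0 ∧ T t s b = φ - P t φ
  stable : ∀ {s t}, s ≤ t → ∀ φ,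
    ‖T t s (P s φ)‖ ≤ K * Real.exp (-(α * (u t - u s))) * Real.exp (θ * |u s|) * ‖φ‖
  unstable : ∀ {s t}, s ≤ t → ∀ b φ, P s b = 0 → T t s b = φ - P t φ →
    ‖b‖ ≤ K * Real.exp (-(β * (u t - u s))) * Real.exp (ν * |u t|) * ‖φ‖

variable {T : ℝ → ℝ → X → X} {P : ℝ → X →L[ℝ] X} {u : ℝ → ℝ} {K α β θ ν : ℝ}

theorem IsLogDichotomy.map_mem (hT : IsEvolution T) (hD : IsLogDichotomy T P u K α β θ ν)
    {s t : ℝ} (hst : s ≤ t) {b : X} (hb : P s b = 0) : P t (T t s b) = 0 := by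
  rw [← hD.invariant hst, hb, hT.zero hst]

/-- `T(t,s)` expands the unstable spaces. -/
theorem IsLogDichotomy.norm_le (hT : IsEvolution T) (hD : IsLogDichotomy T P u K α β θ ν)
    {s t : ℝ} (hst : s ≤ t) {b : X} (hb : P s b = 0) :
    ‖b‖ ≤ K * Real.exp (-(β * (u t - u s))) * Real.exp (ν * |u t|) * ‖T t s b‖ :=
  hD.unstable hst b _ hb (by rw [hD.map_mem hT hst hb, sub_zero])

theorem IsLogDichotomy.injOn (hT : IsEvolution T) (hD : IsLogDichotomy T P u K α β θ ν)
    {s t : ℝ} (hst : s ≤ t) {b c : X} (hb : P s b = 0) (hc : P s c = 0) (h : T t s b = T t s c) :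
    b = c := by
  have h1 := hD.norm_le hT hst (b := b - c) (by rw [map_sub, hb, hc, sub_zero])
  rw [hT.sub hst, h, sub_self, norm_zero, mul_zero, norm_le_zero_iff, sub_eq_zero] at h1
  exact h1

theorem tendsto_stable_weight (hαθ : θ < α) (hu : Tendsto u atBot atBot) (a : ℝ) :
    Tendsto (fun s => Real.exp (-(α * (a - u s))) * Real.exp (θ * |u s|)) atBot (𝓝 0) := by
  have h1 : Tendsto (fun s => Real.exp (-(α * a) + (α - θ) * u s)) atBot (𝓝 0) :=
    Real.tendsto_exp_atBot.comp
      (tendsto_atBot_add_const_left _ _ (hu.const_mul_atBot (sub_pos.2 hαθ)))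
  refine h1.congr' ?_
  filter_upwards [hu.eventually_le_atBot 0] with s hs
  rw [← Real.exp_add, abs_of_nonpos hs]
  ring_nf

theorem tendsto_unstable_weight (hβν : ν < β) (hu : Tendsto u atTop atTop) (a : ℝ) :
    Tendsto (fun s => Real.exp (-(β * (u s - a))) * Real.exp (ν * |u s|)) atTop (𝓝 0) := by
  have h1 : Tendsto (fun s => Real.exp (β * a + (ν - β) * u s)) atTop (𝓝 0) :=
    Real.tendsto_exp_atBot.comp
      (tendsto_atBot_add_const_left _ _ (hu.const_mul_atTop_of_neg (sub_neg.2 hβν)))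
  refine h1.congr' ?_
  filter_upwards [hu.eventually_ge_atTop 0] with s hs
  rw [← Real.exp_add, abs_of_nonneg hs]
  ring_nf

/-- An evolution family with a dichotomy has no nonzero bounded complete trajectory. -/
theorem IsLogDichotomy.eq_zero_of_bounded (hT : IsEvolution T)
    (hD : IsLogDichotomy T P u K α β θ ν) (hαθ : θ < α) (hβν : ν < β)
    (hbot : Tendsto u atBot atBot) (htop : Tendsto u atTop atTop) (hK : 0 ≤ K) {d : ℝ → X} {B : ℝ}
    (hd : ∀ s t, s ≤ t → d t = T t s (d s)) (hB : ∀ t, ‖d t‖ ≤ B) (t : ℝ) : d t = 0 := by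
  have h1 (t : ℝ) : P t (d t) = 0 := by
    have h2 := ((tendsto_stable_weight hαθ hbot (u t)).const_mul K).mul_const B
    rw [mul_zero, zero_mul] at h2
    rw [← norm_le_zero_iff]
    refine ge_of_tendsto h2 ?_
    filter_upwards [eventually_le_atBot t] with s hs
    rw [hd s t hs, ← hD.invariant hs, ← mul_assoc]
    exact (hD.stable hs (d s)).trans (mul_le_mul_of_nonneg_left (hB s) (by positivity))
  have h2 := ((tendsto_unstable_weight hβν htop (u t)).const_mul K).mul_const B
  rw [mul_zero, zero_mul] at h2
  rw [← norm_le_zero_iff]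
  refine ge_of_tendsto h2 ?_
  filter_upwards [eventually_ge_atTop t] with s hs
  rw [← mul_assoc]
  refine (hD.norm_le hT hs (h1 t)).trans ?_
  rw [← hd t s hs]
  exact mul_le_mul_of_nonneg_left (hB s) (by positivity)

variable {V : ℝ → ℝ → X} {A r n : ℝ}

/-- Bound for the stable part of an inhomogeneity `V` satisfying the cocycle identity. A step
from `s` to `c` of length at most `r` contributes at most a multiple of `∫ e^{-α(u(t) - ·)}` over
`[u(s), u(c)]`, and the contributions telescope. -/
theorem norm_stable_le (hT : IsEvolution T) (hD : IsLogDichotomy T P u K α β θ ν)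
    (hK : 0 ≤ K) (hA : 0 ≤ A) (hα : 0 < α) (hr : 0 < r) (hu : Monotone u)
    (hn : ∀ s, u (s + r) - u s ≤ n)
    (hV : ∀ {s c t}, s ≤ c → c ≤ t → V t s = T t c (V c s) + V t c)
    (hVb : ∀ {s t}, s ≤ t → t ≤ s + r → ‖V t s‖ ≤ A * Real.exp (-(θ * |u t|)) * (u t - u s))
    {s c t : ℝ} (hsc : s ≤ c) (hct : c ≤ t) :
    ‖T t c (P c (V c s))‖ ≤ K * A * (Real.exp (α * n) / α) *
      (Real.exp (-(α * (u t - u c))) - Real.exp (-(α * (u t - u s)))) := by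
  have single {s c : ℝ} (hsc : s ≤ c) (hct : c ≤ t) (hcs : c ≤ s + r) :
      ‖T t c (P c (V c s))‖ ≤ K * A * (Real.exp (α * n) / α) *
        (Real.exp (-(α * (u t - u c))) - Real.exp (-(α * (u t - u s)))) := by
    have h1 : α * (u c - u s) ≤ Real.exp (α * n) * (1 - Real.exp (-(α * (u c - u s)))) := by
      have h2 := Real.add_one_le_exp (α * (u c - u s))
      have h3 : u c - u s ≤ n := by linarith [hu hcs, hn s]
      have h4 : Real.exp (-(α * (u c - u s))) ≤ 1 :=
        Real.exp_le_one_iff.2 (by have := hu hsc; nlinarith)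
      calc α * (u c - u s) ≤ Real.exp (α * (u c - u s)) - 1 := by linarith
        _ = Real.exp (α * (u c - u s)) * (1 - Real.exp (-(α * (u c - u s)))) := by
            rw [mul_sub (Real.exp _), ← Real.exp_add, mul_one, add_neg_cancel, Real.exp_zero]
        _ ≤ _ := by
            have : 0 ≤ 1 - Real.exp (-(α * (u c - u s))) := by linarith
            gcongr
    calc ‖T t c (P c (V c s))‖
        ≤ K * Real.exp (-(α * (u t - u c))) * Real.exp (θ * |u c|) *
          (A * Real.exp (-(θ * |u c|)) * (u c - u s)) := by
          refine (hD.stable hct _).trans ?_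
          exact mul_le_mul_of_nonneg_left (hVb hsc hcs) (by positivity)
      _ = K * A * Real.exp (-(α * (u t - u c))) *
          (Real.exp (θ * |u c|) * Real.exp (-(θ * |u c|))) * (u c - u s) := by ring
      _ = K * A * Real.exp (-(α * (u t - u c))) / α * (α * (u c - u s)) := by
          rw [← Real.exp_add, add_neg_cancel, Real.exp_zero]
          field_simp
      _ ≤ K * A * Real.exp (-(α * (u t - u c))) / α *
          (Real.exp (α * n) * (1 - Real.exp (-(α * (u c - u s))))) := by gcongr
      _ = K * A * (Real.exp (α * n) / α) * (Real.exp (-(α * (u t - u c))) -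
          Real.exp (-(α * (u t - u c))) * Real.exp (-(α * (u c - u s)))) := by ring
      _ = _ := by
          rw [← Real.exp_add]
          ring_nf
  have hVcc : V c c = 0 := by
    have := hV (le_refl c) (le_refl c)
    rw [hT.self] at this
    simpa using this
  refine backward_step_induction (p := fun s => ‖T t c (P c (V c s))‖ ≤
    K * A * (Real.exp (α * n) / α) *
      (Real.exp (-(α * (u t - u c))) - Real.exp (-(α * (u t - u s))))) hr ?_ ?_ hsc
  · simp [hVcc, hT.zero hct]
  · intro s c' hsc' hc' hc'c ih
    rw [hV hsc' hc'c, map_add, hT.add hct, ← hD.invariant hc'c, hT.comp hc'c hct]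
    refine (norm_add_le _ _).trans ((add_le_add (single hsc' (hc'c.trans hct) hc') ih).trans ?_)
    exact le_of_eq (by ring)

/-- Bound for the backward continuation to time `t` of the unstable part of `V(c,s)`, by the same
telescoping argument. -/
theorem norm_unstable_le (hT : IsEvolution T) (hD : IsLogDichotomy T P u K α β θ ν)
    (hK : 0 ≤ K) (hA : 0 ≤ A) (hβ : 0 < β) (hνθ : ν ≤ θ) (hr : 0 < r) (hu : Monotone u)
    (hV : ∀ {s c t}, s ≤ c → c ≤ t → V t s = T t c (V c s) + V t c)
    (hVb : ∀ {s t}, s ≤ t → t ≤ s + r → ‖V t s‖ ≤ A * Real.exp (-(θ * |u t|)) * (u t - u s))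
    {t s c : ℝ} (hts : t ≤ s) (hsc : s ≤ c) {b : X} (hb : P t b = 0)
    (hbc : T c t b = V c s - P c (V c s)) :
    ‖b‖ ≤ K * A / β *
      (Real.exp (-(β * (u s - u t))) - Real.exp (-(β * (u c - u t)))) := by
  have single {s c : ℝ} (hts : t ≤ s) (hsc : s ≤ c) (hcs : c ≤ s + r) {b : X} (hb : P t b = 0)
      (hbc : T c t b = V c s - P c (V c s)) : ‖b‖ ≤ K * A / β *
        (Real.exp (-(β * (u s - u t))) - Real.exp (-(β * (u c - u t)))) := by
    have h2 := Real.add_one_le_exp (β * (u c - u s))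
    have h5 : 0 ≤ u c - u s := by linarith [hu hsc]
    calc ‖b‖ ≤ K * Real.exp (-(β * (u c - u t))) * Real.exp (ν * |u c|) *
          (A * Real.exp (-(θ * |u c|)) * (u c - u s)) := by
          refine (hD.unstable (hts.trans hsc) b _ hb hbc).trans ?_
          exact mul_le_mul_of_nonneg_left (hVb hsc hcs) (by positivity)
      _ ≤ K * Real.exp (-(β * (u c - u t))) * Real.exp (θ * |u c|) *
          (A * Real.exp (-(θ * |u c|)) * (u c - u s)) := by gcongr
      _ = K * A * Real.exp (-(β * (u c - u t))) *
          (Real.exp (θ * |u c|) * Real.exp (-(θ * |u c|))) * (u c - u s) := by ring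
      _ = K * A * Real.exp (-(β * (u c - u t))) / β * (β * (u c - u s)) := by
          rw [← Real.exp_add, add_neg_cancel, Real.exp_zero]
          field_simp
      _ ≤ K * A * Real.exp (-(β * (u c - u t))) / β * (Real.exp (β * (u c - u s)) - 1) := by
          gcongr
          linarith
      _ = K * A / β * (Real.exp (-(β * (u c - u t))) * Real.exp (β * (u c - u s)) -
          Real.exp (-(β * (u c - u t)))) := by ring
      _ = _ := by
          rw [← Real.exp_add]
          ring_nf
  have hVcc : V c c = 0 := by
    have := hV (le_refl c) (le_refl c)
    rw [hT.self] at this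
    simpa using this
  refine backward_step_induction (p := fun s => t ≤ s → ∀ b, P t b = 0 →
    T c t b = V c s - P c (V c s) → ‖b‖ ≤ K * A / β *
      (Real.exp (-(β * (u s - u t))) - Real.exp (-(β * (u c - u t))))) hr ?_ ?_ hsc hts b hb hbc
  · intro htc b hb hbc
    have := hD.unstable htc b 0 hb (by rw [hbc, hVcc])
    simpa using this
  · intro s c' hsc' hc' hc'c ih hts b hb hbc
    have htc' := hts.trans hsc'
    obtain ⟨b₁, hb₁, h₁⟩ := hD.surj htc' (V c' s)
    obtain ⟨b₂, hb₂, h₂⟩ := hD.surj (htc'.trans hc'c) (V c c')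
    have hsum : b = b₁ + b₂ := by
      refine hD.injOn hT (htc'.trans hc'c) hb (by rw [map_add, hb₁, hb₂, add_zero]) ?_
      rw [hT.add (htc'.trans hc'c), h₂, ← hT.comp htc' hc'c b₁, h₁, hT.sub hc'c, hbc,
        hV hsc' hc'c, map_add, hD.invariant hc'c]
      abel
    rw [hsum]
    refine (norm_add_le _ _).trans ((add_le_add (single hts hsc' hc' hb₁ h₁)
      (ih htc' b₂ hb₂ h₂)).trans ?_)
    exact le_of_eq (by ring)

/-- Perron's method: the inhomogeneous equation with forcing `V` has a bounded complete solution,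
the sum of the limits of `P(t)V(t,s)` as `s → -∞` and of the backward continuations to time `t` of
`-(I - P(s))V(s,t)` as `s → ∞`. -/
theorem IsLogDichotomy.exists_bounded_solution [CompleteSpace X] (hT : IsEvolution T)
    (hD : IsLogDichotomy T P u K α β θ ν) (hK : 0 ≤ K) (hA : 0 ≤ A) (hα : 0 < α) (hβ : 0 < β)
    (hνθ : ν ≤ θ) (hr : 0 < r) (hu : Monotone u) (hbot : Tendsto u atBot atBot)
    (htop : Tendsto u atTop atTop) (hn : ∀ s, u (s + r) - u s ≤ n)
    (hV : ∀ {s c t}, s ≤ c → c ≤ t → V t s = T t c (V c s) + V t c)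
    (hVb : ∀ {s t}, s ≤ t → t ≤ s + r → ‖V t s‖ ≤ A * Real.exp (-(θ * |u t|)) * (u t - u s)) :
    ∃ z : ℝ → X, (∀ s t, s ≤ t → z t = T t s (z s) + V t s) ∧
      ∀ t, ‖z t‖ ≤ K * A * (Real.exp (α * n) / α) + K * A / β := by
  have hVtt (t : ℝ) : V t t = 0 := by
    have := hV (le_refl t) (le_refl t)
    rw [hT.self] at this
    simpa using this
  set C₁ := K * A * (Real.exp (α * n) / α) with hC₁
  set C₂ := K * A / β with hC₂
  have hC₁0 : 0 ≤ C₁ := by positivity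
  have hC₂0 : 0 ≤ C₂ := by positivity
  have hdec₁ (a : ℝ) : Tendsto (fun s => C₁ * Real.exp (-(α * (a - u s)))) atBot (𝓝 0) := by
    have := (tendsto_stable_weight hα hbot a).const_mul C₁
    simpa using this
  have hdec₂ (a : ℝ) : Tendsto (fun s => C₂ * Real.exp (-(β * (u s - a)))) atTop (𝓝 0) := by
    have := (tendsto_unstable_weight hβ htop a).const_mul C₂
    simpa using this
  -- the stable part, as a limit `s → -∞`
  have hS (t : ℝ) : ∃ S, ∀ s, s ≤ t → ‖S - P t (V t s)‖ ≤ C₁ * Real.exp (-(α * (u t - u s))) := by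
    obtain ⟨S, hS⟩ := exists_limit_of_norm_sub_le (x := fun s => P t (V t (-s))) (t := -t)
      ((hdec₁ (u t)).comp tendsto_neg_atTop_atBot) (by
        intro s s' hs hs'
        have h1 : -s ≤ t := by linarith
        have h2 : -s' ≤ -s := by linarith
        rw [hV h2 h1, map_add, add_sub_cancel_right, ← hD.invariant h1]
        refine (norm_stable_le hT hD hK hA hα hr hu hn hV hVb h2 h1).trans ?_
        refine mul_le_mul_of_nonneg_left ?_ hC₁0
        exact sub_le_self _ (Real.exp_pos _).le)
    refine ⟨S, fun s hs => ?_⟩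
    have := hS (-s) (by linarith)
    simpa using this
  choose S hS using hS
  -- the backward continuations of the unstable part of `V(s,t)`, and their limit as `s → ∞`
  have hx (t s : ℝ) : ∃ b, t ≤ s → P t b = 0 ∧ T s t b = V s t - P s (V s t) := by
    by_cases hts : t ≤ s
    · obtain ⟨b, hb⟩ := hD.surj hts (V s t)
      exact ⟨b, fun _ => hb⟩
    · exact ⟨0, fun h => absurd h hts⟩
  choose x hx using hx
  have hN (t : ℝ) : ∃ N, ∀ s, t ≤ s → ‖N - x t s‖ ≤ C₂ * Real.exp (-(β * (u s - u t))) := by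
    refine exists_limit_of_norm_sub_le (x := fun s => x t s) (hdec₂ (u t)) ?_
    intro s s' hs hs'
    obtain ⟨h1, h2⟩ := hx t s hs
    obtain ⟨h3, h4⟩ := hx t s' (hs.trans hs')
    refine (norm_unstable_le hT hD hK hA hβ hνθ hr hu hV hVb hs hs' (b := x t s' - x t s)
      (by rw [map_sub, h1, h3, sub_zero]) ?_).trans ?_
    · rw [hT.sub (hs.trans hs'), h4, ← hT.comp hs hs', h2, hT.sub hs', hV hs hs', map_add,
        hD.invariant hs']
      abel
    · refine mul_le_mul_of_nonneg_left ?_ hC₂0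
      exact sub_le_self _ (Real.exp_pos _).le
  choose N hN using hN
  have hSlim (t : ℝ) : Tendsto (fun s => P t (V t s)) atBot (𝓝 (S t)) := by
    rw [tendsto_iff_norm_sub_tendsto_zero]
    refine squeeze_zero' (Eventually.of_forall fun s => norm_nonneg _) ?_ (hdec₁ (u t))
    filter_upwards [eventually_le_atBot t] with s hs
    rw [norm_sub_rev]
    exact hS t s hs
  have hNlim (t : ℝ) : Tendsto (fun s => x t s) atTop (𝓝 (N t)) := by
    rw [tendsto_iff_norm_sub_tendsto_zero]
    refine squeeze_zero' (Eventually.of_forall fun s => norm_nonneg _) ?_ (hdec₂ (u t))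
    filter_upwards [eventually_ge_atTop t] with s hs
    rw [norm_sub_rev]
    exact hN t s hs
  have hSeq {σ t : ℝ} (hσt : σ ≤ t) : S t = T t σ (S σ) + P t (V t σ) := by
    refine tendsto_nhds_unique (hSlim t) ?_
    have h1 : Tendsto (fun s => T t σ (P σ (V σ s)) + P t (V t σ)) atBot
        (𝓝 (T t σ (S σ) + P t (V t σ))) :=
      (((hT.cont hσt).tendsto _).comp (hSlim σ)).add_const _
    refine h1.congr' ?_
    filter_upwards [eventually_le_atBot σ] with s hs
    rw [hV hs hσt, map_add, hD.invariant hσt]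
  have hNeq {σ t : ℝ} (hσt : σ ≤ t) : T t σ (N σ) = N t + (V t σ - P t (V t σ)) := by
    refine tendsto_nhds_unique (((hT.cont hσt).tendsto _).comp (hNlim σ)) ?_
    refine ((hNlim t).add_const (V t σ - P t (V t σ))).congr' ?_
    filter_upwards [eventually_ge_atTop t] with s hs
    obtain ⟨h1, h2⟩ := hx t s hs
    obtain ⟨h3, h4⟩ := hx σ s (hσt.trans hs)
    refine hD.injOn hT hs ?_ (hD.map_mem hT hσt h3) ?_
    · rw [map_add, map_sub, h1, hD.proj, sub_self, add_zero]
    · change _ = T s t (T t σ (x σ s))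
      rw [hT.add hs, h2, hT.comp hσt hs, h4, hT.sub hs, hD.invariant hs, hV hσt hs, map_add]
      abel
  refine ⟨fun t => S t - N t, fun s t hst => ?_, fun t => ?_⟩
  · simp only
    rw [hT.sub hst, hNeq hst, hSeq hst]
    abel
  · have h1 : ‖S t‖ ≤ C₁ := by
      have := hS t t le_rfl
      simpa [hVtt] using this
    have h2 : ‖N t‖ ≤ C₂ := by
      have h3 : x t t = 0 := by
        have := (hx t t le_rfl).2
        rw [hT.self, hVtt] at this
        simpa using this
      have := hN t t le_rfl
      simpa [h3] using this
    exact (norm_sub_le _ _).trans (add_le_add h1 h2)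

end Perron

/-! ### The linear equation with forcing -/

/-- A rate `u = log μ`: a nondecreasing differentiable function tending to `±∞` at `±∞` whose
increments over intervals of length `r` are at most `n`. -/
structure IsLogRate (u : ℝ → ℝ) (r n : ℝ) : Prop where
  monotone : Monotone u
  differentiable : Differentiable ℝ u
  tendsto_atTop : Tendsto u atTop atTop
  tendsto_atBot : Tendsto u atBot atBot
  step : ∀ s, u (s + r) - u s ≤ n

namespace IsLogRate

variable {u : ℝ → ℝ} {r n : ℝ}

theorem deriv_nonneg (hu : IsLogRate u r n) (t : ℝ) : 0 ≤ deriv u t :=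
  hu.monotone.deriv_nonneg

theorem intervalIntegrable_deriv (hu : IsLogRate u r n) (a b : ℝ) :
    IntervalIntegrable (deriv u) volume a b :=
  (hu.monotone.monotoneOn _).intervalIntegrable_deriv

theorem locallyIntegrable_deriv (hu : IsLogRate u r n) : LocallyIntegrable (deriv u) volume := by
  intro x
  refine ⟨Ioc (x - 1) (x + 1), Ioc_mem_nhds (by linarith) (by linarith), ?_⟩
  exact (intervalIntegrable_iff_integrableOn_Ioc_of_le (by linarith)).1
    (hu.intervalIntegrable_deriv _ _)

theorem integral_deriv (hu : IsLogRate u r n) (a b : ℝ) :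
    ∫ τ in a..b, deriv u τ = u b - u a :=
  intervalIntegral.integral_deriv_eq_sub (fun x _ => hu.differentiable x)
    (hu.intervalIntegrable_deriv a b)

theorem abs_sub_le (hu : IsLogRate u r n) {s t : ℝ} (hst : s ≤ t) (hts : t ≤ s + r) :
    |(|u s| - |u t|)| ≤ n := by
  refine (abs_abs_sub_abs_le _ _).trans ?_
  rw [abs_sub_comm, abs_of_nonneg (sub_nonneg.2 (hu.monotone hst))]
  linarith [hu.monotone hts, hu.step s]

end IsLogRate

section Forced

variable {r : ℝ} {E : Type u} [NormedAddCommGroup E] [NormedSpace ℝ E] [CompleteSpace E]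
  {η : Kernel r E} {ℓ : ℝ → ℝ} {f f' : ℝ → E}

/-- The vector field `(t, φ) ↦ L(t)φ + f(t)`. -/
def forced (η : Kernel r E) (f : ℝ → E) (t : ℝ) (φ : Phase r E) : E := η.LC t φ + f t

/-- The operators `T(t,s)`, for `t ≥ s`, as solution operators of the integral equation. -/
abbrev linFlow (η : Kernel r E) : ℝ → ℝ → Phase r E → Phase r E := flow (forced η 0)

/-- The segment at time `t` of the solution of `x' = L(t)x_t + f(t)` with `x_s = 0`. -/
def response (η : Kernel r E) (f : ℝ → E) (t s : ℝ) : Phase r E := flow (forced η f) t s 0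

/-- A locally integrable function dominates the operators `L(t)`. -/
structure IsLBound (η : Kernel r E) (ℓ : ℝ → ℝ) : Prop where
  locallyIntegrable : LocallyIntegrable ℓ volume
  nonneg : ∀ t, 0 ≤ ℓ t
  norm_le : ∀ t φ, ‖η.LC t φ‖ ≤ ℓ t * ‖φ‖

variable [FiniteDimensional ℝ E]

theorem IsLBound.isField_forced (hL : IsLBound η ℓ) (hf : LocallyIntegrable f volume) :
    IsField (forced η f) (fun t => ℓ t + ‖f t‖) where
  locallyIntegrable := hL.locallyIntegrable.add fun x => (hf x).norm
  nonneg t := add_nonneg (hL.nonneg t) (norm_nonneg _)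
  measurable z hz :=
    (η.stronglyMeasurable_LC_comp hz).aestronglyMeasurable.add hf.aestronglyMeasurable
  lipschitz t φ ψ := by
    rw [forced, forced, add_sub_add_right_eq_sub, ← map_sub]
    refine (hL.norm_le t _).trans ?_
    have := norm_nonneg (f t)
    gcongr
    linarith
  norm_zero_le t := by
    rw [forced, map_zero, zero_add]
    linarith [hL.nonneg t]

theorem IsLBound.isField_zero (hL : IsLBound η ℓ) : IsField (forced η 0) ℓ := by
  have := hL.isField_forced (f := 0) locallyIntegrable_zero
  simpa using this

/-- Superposition. -/
theorem IsLBound.flow_sub (hr : 0 ≤ r) (hL : IsLBound η ℓ) (hf : LocallyIntegrable f volume)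
    (hf' : LocallyIntegrable f' volume) {s t : ℝ} (hst : s ≤ t) (φ ψ : Phase r E) :
    flow (forced η f) t s φ - flow (forced η f') t s ψ =
      flow (forced η (f - f')) t s (φ - ψ) := by
  have hF := hL.isField_forced hf
  have hF' := hL.isField_forced hf'
  have hF'' := hL.isField_forced (hf.sub hf')
  obtain ⟨x, rfl, hx, h⟩ := hF.exists_flow_eq hr s φ
  obtain ⟨y, rfl, hy, h'⟩ := hF'.exists_flow_eq hr s ψ
  rw [h t hst, h' t hst, ← seg_sub, ← seg_sub]
  refine (hF''.flow_seg hr hst ?_).symm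
  intro σ hσ
  have hi := hF.locallyIntegrable_comp (continuous_seg x)
  have hj := hF'.locallyIntegrable_comp (continuous_seg y)
  have h1 : ∀ τ, forced η (f - f') τ (seg r (x - y) τ) =
      forced η f τ (seg r x τ) - forced η f' τ (seg r y τ) := by
    intro τ
    simp only [forced, seg_sub, map_sub, Pi.sub_apply]
    abel
  simp only [h1]
  rw [intervalIntegral.integral_sub (hi.intervalIntegrable _ _) (hj.intervalIntegrable _ _),
    ContinuousMap.sub_apply, ContinuousMap.sub_apply, hx σ hσ, hy σ hσ]
  abel

theorem IsLBound.isEvolution (hr : 0 ≤ r) (hL : IsLBound η ℓ) : IsEvolution (linFlow η) where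
  self := hL.isField_zero.flow_self hr
  comp := hL.isField_zero.flow_flow hr
  sub hst φ ψ := by
    have := hL.flow_sub (f := 0) (f' := 0) hr locallyIntegrable_zero locallyIntegrable_zero hst φ ψ
    rw [sub_zero] at this
    exact this.symm
  cont := hL.isField_zero.continuous_flow hr

theorem IsLBound.flow_forced (hr : 0 ≤ r) (hL : IsLBound η ℓ) (hf : LocallyIntegrable f volume)
    {s t : ℝ} (hst : s ≤ t) (φ : Phase r E) :
    flow (forced η f) t s φ = linFlow η t s φ + response η f t s := by
  have := hL.flow_sub (f' := 0) hr hf locallyIntegrable_zero hst φ φ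
  rw [sub_zero, sub_self, sub_eq_iff_eq_add] at this
  rw [this, response, add_comm]

theorem IsLBound.response_sub (hr : 0 ≤ r) (hL : IsLBound η ℓ) (hf : LocallyIntegrable f volume)
    (hf' : LocallyIntegrable f' volume) {s t : ℝ} (hst : s ≤ t) :
    response η (f - f') t s = response η f t s - response η f' t s := by
  have := hL.flow_sub hr hf hf' hst 0 0
  rw [sub_zero] at this
  exact this.symm

theorem IsLBound.response_cocycle (hr : 0 ≤ r) (hL : IsLBound η ℓ)
    (hf : LocallyIntegrable f volume) {s c t : ℝ} (hsc : s ≤ c) (hct : c ≤ t) :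
    response η f t s = linFlow η t c (response η f c s) + response η f t c := by
  rw [← hL.flow_forced hr hf hct, response, response, (hL.isField_forced hf).flow_flow hr hsc hct]

/-- A crude bound for the response to a forcing, by Gronwall's inequality. -/
theorem IsLBound.norm_response_le (hr : 0 ≤ r) (hL : IsLBound η ℓ)
    (hf : LocallyIntegrable f volume) {s t A : ℝ} (hst : s ≤ t) (hA : ∫ τ in s..t, ‖f τ‖ ≤ A) :
    ‖response η f t s‖ ≤ 2 * A * Real.exp (2 * ∫ τ in s..t, ℓ τ) := by
  have hfn : LocallyIntegrable (fun τ => ‖f τ‖) volume := fun x => (hf x).norm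
  have hF := hL.isField_forced hf
  obtain ⟨x, hxs, hx, h⟩ := hF.exists_flow_eq hr s 0
  rw [response, h t hst]
  have hA0 : 0 ≤ A := le_trans
    (intervalIntegral.integral_nonneg hst fun τ _ => norm_nonneg _) hA
  have hx0 (σ : ℝ) (hσ : σ ∈ Icc (s - r) s) : x σ = 0 := by
    have := congrArg (fun ψ : Phase r E => ψ ⟨σ - s, by linarith [hσ.1], by linarith [hσ.2]⟩) hxs
    simpa using this
  refine norm_seg_le_of_integral_bound hL.locallyIntegrable hL.nonneg hA0 ?_ ?_ ⟨hst, le_rfl⟩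
  · intro σ hσ
    rw [hx0 σ hσ, norm_zero]
    exact hA0
  · intro σ hσ
    have hs1 := (hL.locallyIntegrable.intervalIntegrable s σ).mul_continuousOn
      (continuous_seg (r := r) x).norm.continuousOn
    have h2 := hfn.intervalIntegrable s σ
    rw [hx σ hσ.1, hx0 s ⟨by linarith, le_rfl⟩, zero_add]
    have h3 : ‖∫ τ in s..σ, forced η f τ (seg r x τ)‖ ≤
        ∫ τ in s..σ, (‖f τ‖ + ℓ τ * ‖seg r x τ‖) := by
      refine intervalIntegral.norm_integral_le_of_norm_le hσ.1 ?_ (h2.add hs1)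
      refine Eventually.of_forall fun τ _ => ?_
      rw [forced, add_comm]
      exact (norm_add_le _ _).trans (add_le_add le_rfl (hL.norm_le τ _))
    rw [intervalIntegral.integral_add h2 hs1] at h3
    have h4 : ∫ τ in s..σ, ‖f τ‖ ≤ ∫ τ in s..t, ‖f τ‖ :=
      integral_mono_right hfn (fun τ => norm_nonneg _) s hσ.2
    linarith

variable {u : ℝ → ℝ} {n : ℝ}

/-- If the operators `T(t,σ)`, `σ ∈ [s,t]`, have norm at most `B`, the response to a forcing of
size at most `D u'` is bounded by `4BD(u(t) - u(s))`: on steps so short that the crude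
bound loses only a constant factor, the contributions are transported to time `t` and added up. -/
theorem IsLBound.norm_response_le_of_bounded (hr : 0 ≤ r) (hL : IsLBound η ℓ)
    (hu : IsLogRate u r n) (hf : LocallyIntegrable f volume) {s t B D : ℝ} (hst : s ≤ t)
    (hB0 : 0 ≤ B) (hB : ∀ σ ∈ Icc s t, ∀ φ, ‖linFlow η t σ φ‖ ≤ B * ‖φ‖)
    (hD : ∀ τ ∈ Icc s t, ‖f τ‖ ≤ D * deriv u τ) :
    ‖response η f t s‖ ≤ 4 * B * D * (u t - u s) := by
  have hfn : LocallyIntegrable (fun τ => ‖f τ‖) volume := fun x => (hf x).norm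
  set Λ : ℝ → ℝ := fun t => ∫ τ in s..t, ℓ τ with hΛ
  have hΛc : Continuous Λ :=
    intervalIntegral.continuous_primitive hL.locallyIntegrable.intervalIntegrable s
  have huc := (isCompact_Icc (a := s) (b := t)).uniformContinuousOn_of_continuous
    hΛc.continuousOn
  have hlog : 0 < Real.log 2 / 2 := by have := Real.log_pos (one_lt_two); linarith
  obtain ⟨h, hh, hstep⟩ := Metric.uniformContinuousOn_iff.1 huc _ hlog
  have hshort {σ c : ℝ} (hσ : s ≤ σ) (hσc : σ ≤ c) (hc : c ≤ σ + h / 2) (hct : c ≤ t) :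
      ‖response η f c σ‖ ≤ 4 * (D * (u c - u σ)) := by
    have h1 : ∫ τ in σ..c, ‖f τ‖ ≤ D * (u c - u σ) := by
      rw [← hu.integral_deriv, ← intervalIntegral.integral_const_mul]
      refine intervalIntegral.integral_mono_on hσc (hfn.intervalIntegrable _ _)
        ((hu.intervalIntegrable_deriv _ _).const_mul D) fun τ hτ => ?_
      exact hD τ ⟨hσ.trans hτ.1, hτ.2.trans hct⟩
    have h0 : 0 ≤ D * (u c - u σ) := le_trans
      (intervalIntegral.integral_nonneg hσc fun τ _ => norm_nonneg _) h1
    refine (hL.norm_response_le hr hf hσc h1).trans ?_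
    have h2 : ∫ τ in σ..c, ℓ τ ≤ Real.log 2 / 2 := by
      have h3 := hstep c ⟨hσ.trans hσc, hct⟩ σ ⟨hσ, hσc.trans hct⟩ (by
        rw [Real.dist_eq, abs_of_nonneg (by linarith)]
        linarith)
      rw [Real.dist_eq] at h3
      have h4 : Λ c - Λ σ = ∫ τ in σ..c, ℓ τ :=
        intervalIntegral.integral_interval_sub_left
          (hL.locallyIntegrable.intervalIntegrable _ _)
          (hL.locallyIntegrable.intervalIntegrable _ _)
      rw [← h4]
      exact (le_abs_self _).trans h3.le
    have h5 : Real.exp (2 * ∫ τ in σ..c, ℓ τ) ≤ 2 := by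
      calc Real.exp (2 * ∫ τ in σ..c, ℓ τ) ≤ Real.exp (Real.log 2) :=
            Real.exp_le_exp.2 (by linarith)
        _ = 2 := Real.exp_log two_pos
    calc 2 * (D * (u c - u σ)) * Real.exp (2 * ∫ τ in σ..c, ℓ τ)
        ≤ 2 * (D * (u c - u σ)) * 2 := by gcongr
      _ = _ := by ring
  refine backward_step_induction (r := h / 2) (b := t)
    (p := fun σ => s ≤ σ → ‖response η f t σ‖ ≤ 4 * B * D * (u t - u σ))
    (by linarith) ?_ ?_ hst le_rfl
  · intro _
    rw [response, (hL.isField_forced hf).flow_self hr]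
    simp
  · intro σ c hσc hc hct ih hσ
    rw [hL.response_cocycle hr hf hσc hct]
    refine (norm_add_le _ _).trans ((add_le_add ((hB c ⟨hσ.trans hσc, hct⟩ _).trans
      (mul_le_mul_of_nonneg_left (hshort hσ hσc hc hct) hB0)) (ih (hσ.trans hσc))).trans ?_)
    exact le_of_eq (by ring)

/-- The response over a time at most `r`, under nonuniform bounded growth of `T(t,s)`. -/
theorem IsLBound.norm_response_le_of_growth (hr : 0 ≤ r) (hL : IsLBound η ℓ)
    (hu : IsLogRate u r n) (hf : LocallyIntegrable f volume) {B ε θ D : ℝ} (hε : 0 ≤ ε)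
    (hθ : 0 ≤ θ) (hB0 : 0 ≤ B) (hD0 : 0 ≤ D)
    (hB : ∀ s t, s ≤ t → t ≤ s + r → ∀ φ, ‖linFlow η t s φ‖ ≤ B * Real.exp (ε * |u s|) * ‖φ‖)
    (hD : ∀ t, ‖f t‖ ≤ D * (deriv u t * Real.exp (-((θ + ε) * |u t|))))
    {s t : ℝ} (hst : s ≤ t) (hts : t ≤ s + r) :
    ‖response η f t s‖ ≤ 4 * B * Real.exp ((θ + 2 * ε) * n) * D *
      Real.exp (-(θ * |u t|)) * (u t - u s) := by
  have h1 := hL.norm_response_le_of_bounded (B := B * Real.exp (ε * n) * Real.exp (ε * |u t|))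
    (D := D * (Real.exp ((θ + ε) * n) * Real.exp (-((θ + ε) * |u t|)))) hr hu hf hst
    (by positivity) (by
      intro σ hσ φ
      refine (hB σ t hσ.2 (by linarith [hσ.1]) φ).trans ?_
      have h2 := (abs_le.1 (hu.abs_sub_le hσ.2 (by linarith [hσ.1]))).2
      rw [mul_assoc B (Real.exp (ε * n)), ← Real.exp_add]
      have h3 : ε * |u σ| ≤ ε * n + ε * |u t| := by nlinarith
      gcongr) (by
      intro τ hτ
      refine (hD τ).trans ?_
      have h2 := (abs_le.1 (hu.abs_sub_le hτ.2 (by linarith [hτ.1]))).1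
      have h3 : -((θ + ε) * |u τ|) ≤ (θ + ε) * n + -((θ + ε) * |u t|) := by nlinarith
      have h4 := hu.deriv_nonneg τ
      rw [← Real.exp_add, mul_assoc D, mul_comm (deriv u τ)]
      gcongr)
  refine h1.trans (le_of_eq ?_)
  have h2 : Real.exp ((θ + 2 * ε) * n) * Real.exp (-(θ * |u t|)) =
      Real.exp (ε * n) * Real.exp (ε * |u t|) *
        (Real.exp ((θ + ε) * n) * Real.exp (-((θ + ε) * |u t|))) := by
    rw [← Real.exp_add, ← Real.exp_add, ← Real.exp_add, ← Real.exp_add]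
    ring_nf
  calc _ = 4 * B * D * (Real.exp (ε * n) * Real.exp (ε * |u t|) *
        (Real.exp ((θ + ε) * n) * Real.exp (-((θ + ε) * |u t|)))) * (u t - u s) := by ring
    _ = 4 * B * D * (Real.exp ((θ + 2 * ε) * n) * Real.exp (-(θ * |u t|))) * (u t - u s) := by
        rw [h2]
    _ = _ := by ring

end Forced

/-! ### Translation of the hypotheses -/

section Translate

variable {r : ℝ} {E : Type u} [NormedAddCommGroup E] [NormedSpace ℝ E] [CompleteSpace E]
  {η : Kernel r E} {ℓ : ℝ → ℝ} {μ : ℝ → ℝ} {P : ℝ → Phase r E →L[ℝ] Phase r E}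
  {K α β θ ν : ℝ}

theorem IsDiffGrowthRate.div_rpow (hμ : IsDiffGrowthRate μ) (s t x : ℝ) :
    (μ t / μ s) ^ x = Real.exp (x * (Real.log (μ t) - Real.log (μ s))) := by
  rw [Real.rpow_def_of_pos (div_pos (hμ.pos t) (hμ.pos s)),
    Real.log_div (hμ.pos t).ne' (hμ.pos s).ne', mul_comm]

/-- This is where `μ(0) = 1` enters: `log μ(t)` has the sign of `t`. -/
theorem IsDiffGrowthRate.sign_mul_log (hμ : IsDiffGrowthRate μ) (t : ℝ) :
    Real.sign t * Real.log (μ t) = |Real.log (μ t)| := by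
  rcases lt_trichotomy t 0 with h | rfl | h
  · have : Real.log (μ t) < 0 :=
      Real.log_neg (hμ.pos t) (by rw [← hμ.map_zero]; exact hμ.strictMono h)
    rw [Real.sign_of_neg h, abs_of_neg this]
    ring
  · simp [hμ.map_zero]
  · have : 0 < Real.log (μ t) := Real.log_pos (by rw [← hμ.map_zero]; exact hμ.strictMono h)
    rw [Real.sign_of_pos h, abs_of_pos this, one_mul]

theorem IsDiffGrowthRate.rpow_sign (hμ : IsDiffGrowthRate μ) (t x : ℝ) :
    μ t ^ (Real.sign t * x) = Real.exp (x * |Real.log (μ t)|) := by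
  rw [Real.rpow_def_of_pos (hμ.pos t), ← hμ.sign_mul_log]
  ring_nf

theorem IsDiffGrowthRate.isLogRate (hμ : IsDiffGrowthRate μ) {N : ℝ}
    (hN : ∀ s, μ (s + r) / μ s ≤ N) : IsLogRate (fun t => Real.log (μ t)) r (Real.log N) where
  monotone _ _ h := Real.log_le_log (hμ.pos _) (hμ.strictMono.monotone h)
  differentiable t := (hμ.differentiable t).log (hμ.pos t).ne'
  tendsto_atTop := Real.tendsto_log_atTop.comp hμ.tendsto_atTop
  tendsto_atBot := Real.tendsto_log_nhdsGT_zero.comp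
    (tendsto_nhdsWithin_iff.2 ⟨hμ.tendsto_atBot, Eventually.of_forall hμ.pos⟩)
  step s := by
    rw [← Real.log_div (hμ.pos _).ne' (hμ.pos _).ne']
    exact Real.log_le_log (div_pos (hμ.pos _) (hμ.pos _)) (hN s)

theorem IsDiffGrowthRate.deriv_mul_rpow (hμ : IsDiffGrowthRate μ) (t κ : ℝ) :
    deriv μ t * μ t ^ (-(Real.sign t * κ) - 1) =
      deriv (fun t => Real.log (μ t)) t * Real.exp (-(κ * |Real.log (μ t)|)) := by
  rw [deriv.log (hμ.differentiable t) (hμ.pos t).ne', Real.rpow_sub (hμ.pos t), Real.rpow_one,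
    ← mul_neg, hμ.rpow_sign]
  ring_nf

theorem IsDichotomy.mem_U_iff (hP : IsDichotomy η μ P K α β θ ν) (s : ℝ) (b : Phase r E) :
    b ∈ U P s ↔ P s b = 0 := by
  constructor
  · rintro ⟨φ, rfl⟩
    rw [map_sub, hP.proj, sub_self]
  · intro h
    exact ⟨b, by simp [h]⟩

variable [FiniteDimensional ℝ E]

theorem IsLBound.T₀_eq (hr : 0 ≤ r) (hL : IsLBound η ℓ) {s t : ℝ} (hst : s ≤ t) (φ : Phase r E) :
    T₀ η t s φ = linFlow η t s φ :=
  evolution_eq_flow hr hL.isField_zero (fun t ψ => by simp [forced]) hst φ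

theorem IsLBound.T_eq (hr : 0 ≤ r) (hL : IsLBound η ℓ) {s t : ℝ} (hst : s ≤ t) (φ : Phase r E) :
    T η t s φ = linFlow η t s φ := by
  rw [T, evolution_eq_flow hr hL.isField_zero (fun t ψ => by simp [forced]) hst φ, toPhase_coe]

theorem IsDichotomy.isLogDichotomy (hr : 0 ≤ r) (hL : IsLBound η ℓ)
    (hP : IsDichotomy η μ P K α β θ ν) (hμ : IsDiffGrowthRate μ) :
    IsLogDichotomy (linFlow η) P (fun t => Real.log (μ t)) K α β θ ν where
  proj := hP.proj
  invariant {s t} hst φ := by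
    rw [← hL.T_eq hr hst, ← hL.T_eq hr hst]
    exact hP.invariant s t hst φ
  surj {s t} hst φ := by
    obtain ⟨b, hb, h⟩ := (hP.bijOn s t hst).surjOn ⟨φ, rfl⟩
    refine ⟨b, (hP.mem_U_iff s b).1 hb, ?_⟩
    rw [← hL.T_eq hr hst]
    exact h
  stable {s t} hst φ := by
    have := hP.stable s t hst φ
    rw [hL.T_eq hr hst, hμ.div_rpow, hμ.rpow_sign, neg_mul] at this
    exact this
  unstable {s t} hst b φ hb hbφ := by
    have h1 := hP.unstable t s hst φ
    have h2 : Tbar η P s t (φ - P t φ) = b := by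
      rw [← hbφ, ← hL.T_eq hr hst]
      exact (hP.bijOn s t hst).injOn.leftInvOn_invFunOn ((hP.mem_U_iff s b).2 hb)
    rw [h2, hμ.div_rpow, hμ.rpow_sign] at h1
    refine h1.trans (le_of_eq ?_)
    congr 3
    ring_nf

omit [NormedSpace ℝ E] [CompleteSpace E] [FiniteDimensional ℝ E] in
theorem coe_mem_C₀ (φ : Phase r E) : ⇑φ ∈ C₀ r E :=
  ⟨φ.continuous.continuousOn, fun ω₀ _ => ⟨φ ω₀, (φ.continuous.tendsto ω₀).mono_left
    nhdsWithin_le_nhds⟩⟩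

/-- On continuous data and over times at most `r`, bounded growth gives a bound for `T(t,s)`. -/
theorem HasBoundedGrowth.norm_linFlow_le (hr : 0 ≤ r) (hL : IsLBound η ℓ)
    (hμ : IsDiffGrowthRate μ) {N K' a ε : ℝ} (hN : ∀ s, μ (s + r) / μ s ≤ N) (hK' : 0 ≤ K')
    (ha : 0 ≤ a) (hG : HasBoundedGrowth η μ K' a ε) (s t : ℝ) (hst : s ≤ t) (hts : t ≤ s + r)
    (φ : Phase r E) : ‖linFlow η t s φ‖ ≤
      K' * Real.exp (a * Real.log N) * Real.exp (ε * |Real.log (μ s)|) * ‖φ‖ := by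
  have hu := hμ.isLogRate hN
  have hs : Real.log (μ t) - Real.log (μ s) ≤ Real.log N := by
    have h1 := hu.monotone hts
    have h2 := hu.step s
    linarith
  have hs0 : 0 ≤ Real.log (μ t) - Real.log (μ s) := sub_nonneg.2 (hu.monotone hst)
  rw [ContinuousMap.norm_le _ (by positivity)]
  intro ω
  have h := hG s t hst φ (coe_mem_C₀ φ) ω
  rw [hL.T₀_eq hr hst, hμ.div_rpow, hμ.rpow_sign] at h
  refine h.trans ?_
  have hsup : ⨆ ω', ‖φ ω'‖ ≤ ‖φ‖ := Real.iSup_le φ.norm_coe_le_norm (norm_nonneg _)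
  have hsup0 : 0 ≤ ⨆ ω', ‖φ ω'‖ := Real.iSup_nonneg fun ω' => norm_nonneg _
  have hsgn : Real.sign (t - s) * a * (Real.log (μ t) - Real.log (μ s)) ≤ a * Real.log N := by
    have h1 : Real.sign (t - s) ≤ 1 := by
      rcases Real.sign_apply_eq (t - s) with h | h | h <;> rw [h] <;> norm_num
    calc Real.sign (t - s) * a * (Real.log (μ t) - Real.log (μ s))
        ≤ 1 * a * (Real.log (μ t) - Real.log (μ s)) := by gcongr
      _ ≤ _ := by rw [one_mul]; gcongr
  gcongr

end Translate

/-! ### Complete orbits in the unstable bundle -/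

section Orbit

variable {X : Type u} [NormedAddCommGroup X] [NormedSpace ℝ X]
  {T : ℝ → ℝ → X → X} {P : ℝ → X →L[ℝ] X} {u : ℝ → ℝ} {K α β θ ν : ℝ}

/-- A complete orbit of the evolution family `T` inside the unstable spaces `ker P(t)`. -/
structure IsOrbit (T : ℝ → ℝ → X → X) (P : ℝ → X →L[ℝ] X) (y : ℝ → X) : Prop where
  mem : ∀ t, P t (y t) = 0
  eq : ∀ s t, s ≤ t → y t = T t s (y s)

/-- Points of the unstable spaces have complete orbits: backward in time, `T(t,s)` is inverted on
the unstable spaces. -/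
theorem IsLogDichotomy.exists_isOrbit (hT : IsEvolution T) (hD : IsLogDichotomy T P u K α β θ ν)
    {s : ℝ} {b : X} (hb : P s b = 0) : ∃ y, IsOrbit T P y ∧ y s = b := by
  have hback (t : ℝ) : ∃ c, t ≤ s → P t c = 0 ∧ T s t c = b := by
    by_cases hts : t ≤ s
    · obtain ⟨c, hc, h⟩ := hD.surj hts b
      exact ⟨c, fun _ => ⟨hc, by rw [h, hb, sub_zero]⟩⟩
    · exact ⟨0, fun h => absurd h hts⟩
  choose c hc using hback
  classical
  let y : ℝ → X := fun t => if s ≤ t then T t s b else c t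
  have hy1 {t : ℝ} (ht : s ≤ t) : y t = T t s b := if_pos ht
  have hy2 {t : ℝ} (ht : t ≤ s) : P t (y t) = 0 ∧ T s t (y t) = b := by
    rcases ht.eq_or_lt with rfl | h
    · rw [hy1 le_rfl, hT.self, hT.self]
      exact ⟨hb, rfl⟩
    · have : y t = c t := if_neg (not_le.2 h)
      rw [this]
      exact hc t ht
  refine ⟨y, ⟨fun t => ?_, fun t t' htt' => ?_⟩, ?_⟩
  · rcases le_total s t with h | h
    · rw [hy1 h]
      exact hD.map_mem hT h hb
    · exact (hy2 h).1
  · rcases le_total s t with h | h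
    · rw [hy1 h, hy1 (h.trans htt'), hT.comp h htt']
    · obtain ⟨h1, h2⟩ := hy2 h
      rcases le_total s t' with h' | h'
      · rw [hy1 h', ← h2, hT.comp h h']
      · obtain ⟨h3, h4⟩ := hy2 h'
        refine hD.injOn hT h' h3 (hD.map_mem hT htt' h1) ?_
        rw [h4, hT.comp htt' h', h2]
  · rw [hy1 le_rfl, hT.self]

theorem IsOrbit.ext (hT : IsEvolution T) (hD : IsLogDichotomy T P u K α β θ ν) {y y' : ℝ → X}
    (hy : IsOrbit T P y) (hy' : IsOrbit T P y') {s : ℝ} (h : y s = y' s) : y = y' := by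
  funext t
  rcases le_total s t with hst | hts
  · rw [hy.eq s t hst, hy'.eq s t hst, h]
  · exact hD.injOn hT hts (hy.mem t) (hy'.mem t) (by rw [← hy.eq t s hts, ← hy'.eq t s hts, h])

theorem IsOrbit.norm_sub_le (hT : IsEvolution T) (hD : IsLogDichotomy T P u K α β θ ν)
    {y y' : ℝ → X} (hy : IsOrbit T P y) (hy' : IsOrbit T P y') {s t : ℝ} (hst : s ≤ t) :
    ‖y s - y' s‖ ≤
      K * Real.exp (-(β * (u t - u s))) * Real.exp (ν * |u t|) * ‖y t - y' t‖ := by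
  rw [hy.eq s t hst, hy'.eq s t hst, ← hT.sub hst]
  exact hD.norm_le hT hst (by rw [map_sub, hy.mem, hy'.mem, sub_zero])

end Orbit

/-! ### Bounded perturbations of unstable orbits -/

section Nonlinear

variable {r : ℝ} {E : Type u} [NormedAddCommGroup E] [NormedSpace ℝ E] [CompleteSpace E]

/-- The nonlinear perturbations considered, in terms of the rate `u = log μ`. -/
structure IsLogPerturbation (u : ℝ → ℝ) (g : ℝ → Phase r E → E) (δ κ : ℝ) : Prop where
  continuous : Continuous (Function.uncurry g)
  map_zero : ∀ t, g t 0 = 0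
  lipschitz : ∀ t φ ψ, ‖g t φ - g t ψ‖ ≤
    δ * min 1 ‖φ - ψ‖ * (deriv u t * Real.exp (-(κ * |u t|)))

/-- The vector field `(t, φ) ↦ L(t)φ + g(t, φ)`. -/
def perturbed (η : Kernel r E) (g : ℝ → Phase r E → E) (t : ℝ) (φ : Phase r E) : E :=
  η.LC t φ + g t φ

/-- The standing assumptions on the linear equation: a dichotomy with rate `u`, and bounded
solutions, of norm at most `C D`, for all continuous forcings of size at most
`D u' e^{-(θ+ε)|u|}`. -/
structure IsPerronSystem (η : Kernel r E) (P : ℝ → Phase r E →L[ℝ] Phase r E) (ℓ u : ℝ → ℝ)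
    (n K α β θ ν ε C : ℝ) : Prop where
  r_pos : 0 < r
  bound : IsLBound η ℓ
  rate : IsLogRate u r n
  dichotomy : IsLogDichotomy (linFlow η) P u K α β θ ν
  K_nonneg : 0 ≤ K
  C_nonneg : 0 ≤ C
  β_nonneg : 0 ≤ β
  θ_lt : θ < α
  ν_lt : ν < β
  exists_bounded : ∀ (f : ℝ → E) (D : ℝ), Continuous f → 0 ≤ D →
    (∀ t, ‖f t‖ ≤ D * (deriv u t * Real.exp (-((θ + ε) * |u t|)))) →
    ∃ z : ℝ → Phase r E, (∀ s t, s ≤ t → z t = linFlow η t s (z s) + response η f t s) ∧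
      ∀ t, ‖z t‖ ≤ C * D

/-- `v` is the bounded deviation of a complete solution of the perturbed equation from the orbit
`y` of the linear equation. -/
def IsDeviation (η : Kernel r E) (g : ℝ → Phase r E → E) (y : ℝ → Phase r E)
    (v : BoundedContinuousFunction ℝ (Phase r E)) : Prop :=
  ∀ s t, s ≤ t → v t = linFlow η t s (v s) + response η (fun τ => g τ (y τ + v τ)) t s

variable [FiniteDimensional ℝ E] {η : Kernel r E} {P : ℝ → Phase r E →L[ℝ] Phase r E}
  {ℓ u : ℝ → ℝ} {n K α β θ ν ε C δ κ : ℝ} {g : ℝ → Phase r E → E} {y y' : ℝ → Phase r E}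
  {v v' : BoundedContinuousFunction ℝ (Phase r E)}

theorem IsLogPerturbation.isField (hg : IsLogPerturbation u g δ κ) (hL : IsLBound η ℓ)
    (hu : IsLogRate u r n) (hδ : 0 ≤ δ) (hκ : 0 ≤ κ) :
    IsField (perturbed η g) (fun t => ℓ t + δ * deriv u t) where
  locallyIntegrable := hL.locallyIntegrable.add (hu.locallyIntegrable_deriv.smul δ)
  nonneg t := add_nonneg (hL.nonneg t) (mul_nonneg hδ (hu.deriv_nonneg t))
  measurable z hz :=
    (η.stronglyMeasurable_LC_comp hz).aestronglyMeasurable.add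
      (hg.continuous.comp (continuous_id.prodMk hz)).aestronglyMeasurable
  lipschitz t φ ψ := by
    rw [perturbed, perturbed, add_sub_add_comm, ← map_sub, add_mul]
    refine (norm_add_le _ _).trans (add_le_add (hL.norm_le t _) ((hg.lipschitz t φ ψ).trans ?_))
    have h1 := hu.deriv_nonneg t
    have h2 : Real.exp (-(κ * |u t|)) ≤ 1 := Real.exp_le_one_iff.2 (by
      have := mul_nonneg hκ (abs_nonneg (u t))
      linarith)
    calc δ * min 1 ‖φ - ψ‖ * (deriv u t * Real.exp (-(κ * |u t|)))
        ≤ δ * ‖φ - ψ‖ * (deriv u t * 1) := by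
          gcongr
          exact min_le_right _ _
      _ = _ := by ring
  norm_zero_le t := by
    have h0 : perturbed η g t 0 = 0 := by
      rw [perturbed, hg.map_zero t, _root_.map_zero, add_zero]
    rw [h0, norm_zero]
    exact add_nonneg (hL.nonneg t) (mul_nonneg hδ (hu.deriv_nonneg t))

omit [NormedSpace ℝ E] [CompleteSpace E] [FiniteDimensional ℝ E] in
theorem IsLogPerturbation.continuous_comp (hg : IsLogPerturbation u g δ κ)
    {z : ℝ → Phase r E} (hz : Continuous z) : Continuous fun t => g t (z t) :=
  hg.continuous.comp (continuous_id.prodMk hz)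

omit [FiniteDimensional ℝ E] in
/-- A curve that follows the solution operators of a vector field on the whole line is
continuous. -/
theorem IsField.continuous_of_complete {F : ℝ → Phase r E → E} (hr : 0 ≤ r) (hF : IsField F ℓ)
    {x : ℝ → Phase r E} (hx : ∀ s t, s ≤ t → x t = flow F t s (x s)) : Continuous x := by
  refine continuous_iff_continuousAt.2 fun t => ?_
  refine (((hF.continuousOn_flow hr (t - 1) (x (t - 1))).congr fun t' ht' => ?_).continuousAt
    (Ici_mem_nhds (by linarith)))
  exact hx _ _ ht'

theorem IsOrbit.continuous (hS : IsPerronSystem η P ℓ u n K α β θ ν ε C)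
    (hy : IsOrbit (linFlow η) P y) : Continuous y :=
  hS.bound.isField_zero.continuous_of_complete hS.r_pos.le hy.eq

theorem IsPerronSystem.isEvolution (hS : IsPerronSystem η P ℓ u n K α β θ ν ε C) :
    IsEvolution (linFlow η) :=
  hS.bound.isEvolution hS.r_pos.le

/-- Uniqueness and the bound for bounded solutions of the linear equation with forcing. -/
theorem IsPerronSystem.norm_sub_le (hS : IsPerronSystem η P ℓ u n K α β θ ν ε C)
    {f f' : ℝ → E} (hf : Continuous f) (hf' : Continuous f') {D : ℝ} (hD : 0 ≤ D)
    (hle : ∀ t, ‖f t - f' t‖ ≤ D * (deriv u t * Real.exp (-((θ + ε) * |u t|))))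
    {z z' : ℝ → Phase r E} {B B' : ℝ}
    (hz : ∀ s t, s ≤ t → z t = linFlow η t s (z s) + response η f t s) (hzB : ∀ t, ‖z t‖ ≤ B)
    (hz' : ∀ s t, s ≤ t → z' t = linFlow η t s (z' s) + response η f' t s)
    (hzB' : ∀ t, ‖z' t‖ ≤ B') (t : ℝ) : ‖z t - z' t‖ ≤ C * D := by
  have hT := hS.isEvolution
  obtain ⟨w, hw, hwC⟩ := hS.exists_bounded (f - f') D (hf.sub hf') hD hle
  have h0 := hS.dichotomy.eq_zero_of_bounded hT hS.θ_lt hS.ν_lt hS.rate.tendsto_atBot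
    hS.rate.tendsto_atTop hS.K_nonneg (d := fun t => w t - (z t - z' t)) (B := C * D + (B + B'))
    (by
      intro s t hst
      rw [hT.sub hst, hT.sub hst, hw s t hst, hz s t hst, hz' s t hst,
        hS.bound.response_sub hS.r_pos.le hf.locallyIntegrable hf'.locallyIntegrable hst]
      abel) (fun t => by
      refine (_root_.norm_sub_le _ _).trans (add_le_add (hwC t) ((_root_.norm_sub_le _ _).trans ?_))
      exact add_le_add (hzB t) (hzB' t)) t
  simp only [sub_eq_zero] at h0
  rw [← h0]
  exact hwC t

/-- Deviations are exactly what has to be added to an orbit of the linear equation to obtain a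
complete solution of the perturbed equation. -/
theorem isDeviation_iff (hS : IsPerronSystem η P ℓ u n K α β θ ν ε C)
    (hg : IsLogPerturbation u g δ κ) (hδ : 0 ≤ δ) (hκ : 0 ≤ κ) (hy : IsOrbit (linFlow η) P y) :
    IsDeviation η g y v ↔
      ∀ s t, s ≤ t → y t + v t = flow (perturbed η g) t s (y s + v s) := by
  have hr := hS.r_pos.le
  have hT := hS.isEvolution
  have hG := hg.isField hS.bound hS.rate hδ hκ
  have hf : Continuous fun τ => g τ (y τ + v τ) :=
    hg.continuous_comp ((hy.continuous hS).add v.continuous)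
  have hF := hS.bound.isField_forced hf.locallyIntegrable
  have hsum {s t : ℝ} (hst : s ≤ t) : flow (forced η fun τ => g τ (y τ + v τ)) t s (y s + v s) =
      y t + (linFlow η t s (v s) + response η (fun τ => g τ (y τ + v τ)) t s) := by
    rw [hS.bound.flow_forced hr hf.locallyIntegrable hst, hT.add hst, ← hy.eq s t hst, add_assoc]
  constructor
  · intro hv
    have h1 (s t : ℝ) (hst : s ≤ t) :
        flow (forced η fun τ => g τ (y τ + v τ)) t s (y s + v s) = y t + v t := by
      rw [hsum hst, ← hv s t hst]
    intro s t hst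
    rw [← h1 s t hst]
    refine hF.flow_congr hr hG hst fun τ hτ => ?_
    rw [h1 s τ hτ]
    rfl
  · intro h s t hst
    have h1 : flow (perturbed η g) t s (y s + v s) =
        flow (forced η fun τ => g τ (y τ + v τ)) t s (y s + v s) := by
      refine hG.flow_congr hr hF hst fun τ hτ => ?_
      rw [← h s τ hτ]
      rfl
    rw [← h s t hst, hsum hst] at h1
    exact add_left_cancel h1

/-- Deviations depend on the orbit in a Lipschitz way, for a metric on orbits that
discounts times where `|u|` is large. -/
theorem IsDeviation.norm_sub_le (hS : IsPerronSystem η P ℓ u n K α β θ ν ε C)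
    (hg : IsLogPerturbation u g δ κ) (hδ : 0 ≤ δ) (hδC : C * δ ≤ 1 / 2) (hκ : θ + ε ≤ κ)
    (hy : IsOrbit (linFlow η) P y) (hy' : IsOrbit (linFlow η) P y') (hv : IsDeviation η g y v)
    (hv' : IsDeviation η g y' v') {d : ℝ} (hd : 0 ≤ d)
    (hle : ∀ τ, min 1 ‖y τ - y' τ‖ * Real.exp (-((κ - (θ + ε)) * |u τ|)) ≤ d) :
    ‖v - v'‖ ≤ d := by
  have hf := hg.continuous_comp ((hy.continuous hS).add v.continuous)
  have hf' := hg.continuous_comp ((hy'.continuous hS).add v'.continuous)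
  have h1 : ‖v - v'‖ ≤ C * (δ * (d + ‖v - v'‖)) := by
    have hCD : 0 ≤ C * (δ * (d + ‖v - v'‖)) := by
      have := hS.C_nonneg
      positivity
    rw [BoundedContinuousFunction.norm_le hCD]
    intro t
    refine hS.norm_sub_le hf hf' (by positivity) (fun τ => ?_) hv v.norm_coe_le_norm hv'
      v'.norm_coe_le_norm t
    refine (hg.lipschitz _ _ _).trans ?_
    have hexp : Real.exp (-(κ * |u τ|)) =
        Real.exp (-((κ - (θ + ε)) * |u τ|)) * Real.exp (-((θ + ε) * |u τ|)) := by
      rw [← Real.exp_add]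
      ring_nf
    have hw : Real.exp (-((κ - (θ + ε)) * |u τ|)) ≤ 1 := Real.exp_le_one_iff.2 (by
      have := mul_nonneg (sub_nonneg.2 hκ) (abs_nonneg (u τ))
      linarith)
    have hmin : min 1 ‖y τ + v τ - (y' τ + v' τ)‖ ≤ min 1 ‖y τ - y' τ‖ + ‖v - v'‖ := by
      have h2 : ‖y τ + v τ - (y' τ + v' τ)‖ ≤ ‖y τ - y' τ‖ + ‖v - v'‖ := by
        rw [add_sub_add_comm]
        exact (norm_add_le _ _).trans (add_le_add le_rfl ((v - v').norm_coe_le_norm τ))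
      rcases min_cases 1 ‖y τ - y' τ‖ with ⟨h, -⟩ | ⟨h, -⟩ <;> rw [h]
      · exact (min_le_left _ _).trans (by linarith [norm_nonneg (v - v')])
      · exact (min_le_right _ _).trans h2
    have hmain : min 1 ‖y τ + v τ - (y' τ + v' τ)‖ * Real.exp (-((κ - (θ + ε)) * |u τ|)) ≤
        d + ‖v - v'‖ := by
      calc _ ≤ (min 1 ‖y τ - y' τ‖ + ‖v - v'‖) * Real.exp (-((κ - (θ + ε)) * |u τ|)) := by
            gcongr
        _ = min 1 ‖y τ - y' τ‖ * Real.exp (-((κ - (θ + ε)) * |u τ|)) +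
            ‖v - v'‖ * Real.exp (-((κ - (θ + ε)) * |u τ|)) := by ring
        _ ≤ d + ‖v - v'‖ * 1 := by
            gcongr
            exact hle τ
        _ = _ := by ring
    have h3 := hS.rate.deriv_nonneg τ
    rw [hexp]
    calc δ * min 1 ‖y τ + v τ - (y' τ + v' τ)‖ * (deriv u τ *
          (Real.exp (-((κ - (θ + ε)) * |u τ|)) * Real.exp (-((θ + ε) * |u τ|))))
        = δ * (min 1 ‖y τ + v τ - (y' τ + v' τ)‖ * Real.exp (-((κ - (θ + ε)) * |u τ|))) *
          (deriv u τ * Real.exp (-((θ + ε) * |u τ|))) := by ring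
      _ ≤ _ := by gcongr
  have h2 : C * (δ * (d + ‖v - v'‖)) ≤ 1 / 2 * (d + ‖v - v'‖) := by
    rw [← mul_assoc]
    gcongr
  linarith

theorem IsDeviation.ext (hS : IsPerronSystem η P ℓ u n K α β θ ν ε C)
    (hg : IsLogPerturbation u g δ κ) (hδ : 0 ≤ δ) (hδC : C * δ ≤ 1 / 2) (hκ : θ + ε ≤ κ)
    (hy : IsOrbit (linFlow η) P y) (hv : IsDeviation η g y v) (hv' : IsDeviation η g y v') :
    v = v' := by
  have := hv.norm_sub_le hS hg hδ hδC hκ hy hy hv' le_rfl (fun τ => by simp)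
  exact sub_eq_zero.1 (norm_le_zero_iff.1 this)

omit [NormedSpace ℝ E] [CompleteSpace E] [FiniteDimensional ℝ E] in
/-- The size of the nonlinearity along any curve. -/
theorem IsLogPerturbation.norm_le (hg : IsLogPerturbation u g δ κ) (hu : IsLogRate u r n)
    (hδ : 0 ≤ δ) (hκ : θ + ε ≤ κ) (t : ℝ) (φ : Phase r E) :
    ‖g t φ‖ ≤ δ * (deriv u t * Real.exp (-((θ + ε) * |u t|))) := by
  have h1 := hg.lipschitz t φ 0
  rw [hg.map_zero, sub_zero, sub_zero] at h1
  have h2 := hu.deriv_nonneg t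
  calc ‖g t φ‖ ≤ δ * min 1 ‖φ‖ * (deriv u t * Real.exp (-(κ * |u t|))) := h1
    _ ≤ δ * 1 * (deriv u t * Real.exp (-((θ + ε) * |u t|))) := by
        gcongr
        exact min_le_left _ _
    _ = _ := by ring

/-- Every orbit of the linear equation in the unstable bundle has a deviation: it is the fixed
point of a contraction on bounded continuous curves. -/
theorem exists_isDeviation (hS : IsPerronSystem η P ℓ u n K α β θ ν ε C)
    (hg : IsLogPerturbation u g δ κ) (hδ : 0 ≤ δ) (hδC : C * δ ≤ 1 / 2) (hκ : θ + ε ≤ κ)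
    (hy : IsOrbit (linFlow η) P y) :
    ∃ v, IsDeviation η g y v ∧ ‖v‖ ≤ C * δ := by
  have hr := hS.r_pos.le
  have hf (v : BoundedContinuousFunction ℝ (Phase r E)) :
      Continuous fun τ => g τ (y τ + v τ) :=
    hg.continuous_comp ((hy.continuous hS).add v.continuous)
  have hex (v : BoundedContinuousFunction ℝ (Phase r E)) :
      ∃ w : BoundedContinuousFunction ℝ (Phase r E), (∀ s t, s ≤ t →
        w t = linFlow η t s (w s) + response η (fun τ => g τ (y τ + v τ)) t s) ∧
        ∀ t, ‖w t‖ ≤ C * δ := by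
    obtain ⟨z, hz, hzC⟩ := hS.exists_bounded _ δ (hf v) hδ
      (fun t => hg.norm_le hS.rate hδ hκ t _)
    have hc : Continuous z := by
      refine (hS.bound.isField_forced (hf v).locallyIntegrable).continuous_of_complete hr ?_
      intro s t hst
      rw [hS.bound.flow_forced hr (hf v).locallyIntegrable hst]
      exact hz s t hst
    exact ⟨BoundedContinuousFunction.ofNormedAddCommGroup z hc (C * δ) hzC, hz, hzC⟩
  choose Φ hΦ hΦC using hex
  have hcontr : ContractingWith (1 / 2) Φ := by
    refine ⟨by norm_num, LipschitzWith.of_dist_le_mul fun v v' => ?_⟩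
    rw [BoundedContinuousFunction.dist_le (by positivity)]
    intro t
    rw [dist_eq_norm, dist_eq_norm v v']
    have h1 := hS.norm_sub_le (hf v) (hf v') (D := δ * ‖v - v'‖) (by positivity) (fun τ => by
        refine (hg.lipschitz _ _ _).trans ?_
        have h2 := hS.rate.deriv_nonneg τ
        rw [add_sub_add_left_eq_sub]
        gcongr
        exact (min_le_right _ _).trans ((v - v').norm_coe_le_norm τ))
      (hΦ v) (hΦC v) (hΦ v') (hΦC v') t
    refine h1.trans ?_
    rw [← mul_assoc]
    refine (mul_le_mul_of_nonneg_right hδC (norm_nonneg (v - v'))).trans (le_of_eq ?_)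
    push_cast
    ring
  have hfix : Φ (hcontr.fixedPoint Φ) = hcontr.fixedPoint Φ := hcontr.fixedPoint_isFixedPt
  refine ⟨hcontr.fixedPoint Φ, ?_, ?_⟩
  · have := hΦ (hcontr.fixedPoint Φ)
    rw [hfix] at this
    exact this
  · rw [BoundedContinuousFunction.norm_le (mul_nonneg hS.C_nonneg hδ)]
    have := hΦC (hcontr.fixedPoint Φ)
    rwa [hfix] at this

/-- Orbits that are close at one time are close for the metric discounting large `|u|`. -/
theorem IsOrbit.exists_forall_min_le (hS : IsPerronSystem η P ℓ u n K α β θ ν ε C) {κ' : ℝ}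
    (hκ' : 0 < κ') (s : ℝ) {d : ℝ} (hd : 0 < d) :
    ∃ ρ > 0, ∀ y y', IsOrbit (linFlow η) P y → IsOrbit (linFlow η) P y' → ‖y s - y' s‖ ≤ ρ →
      ∀ τ, min 1 ‖y τ - y' τ‖ * Real.exp (-(κ' * |u τ|)) ≤ d := by
  have hlim : Tendsto (fun τ => Real.exp (-(κ' * |u τ|))) atTop (𝓝 0) := by
    refine Real.tendsto_exp_atBot.comp (tendsto_neg_atTop_atBot.comp ?_)
    exact (tendsto_abs_atTop_atTop.comp hS.rate.tendsto_atTop).const_mul_atTop hκ'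
  obtain ⟨A, hAs, hA⟩ : ∃ A, s ≤ A ∧ ∀ τ, A ≤ τ → Real.exp (-(κ' * |u τ|)) ≤ d := by
    obtain ⟨A, hA⟩ := eventually_atTop.1 (hlim.eventually (gt_mem_nhds hd))
    exact ⟨max s A, le_max_left _ _, fun τ hτ => (hA τ ((le_max_right _ _).trans hτ)).le⟩
  have hT := hS.isEvolution
  set M₁ := K * Real.exp (ν * |u s|) with hM₁
  set M₂ := 2 * Real.exp (2 * ∫ σ in s..A, ℓ σ) with hM₂
  have hM₁0 : 0 ≤ M₁ := mul_nonneg hS.K_nonneg (Real.exp_pos _).le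
  have hM₂0 : 0 < M₂ := by positivity
  refine ⟨d / (M₁ + M₂), by positivity, fun y y' hy hy' hyy τ => ?_⟩
  have hexp : Real.exp (-(κ' * |u τ|)) ≤ 1 := Real.exp_le_one_iff.2 (by
    have := mul_nonneg hκ'.le (abs_nonneg (u τ))
    linarith)
  rcases le_total A τ with hAτ | hτA
  · calc _ ≤ 1 * Real.exp (-(κ' * |u τ|)) := by
          gcongr
          exact min_le_left _ _
      _ ≤ d := by rw [one_mul]; exact hA τ hAτ
  · have hnear : ‖y τ - y' τ‖ ≤ (M₁ + M₂) * ‖y s - y' s‖ := by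
      rcases le_total τ s with h | h
      · refine (hy.norm_sub_le hT hS.dichotomy hy' h).trans ?_
        have h1 : Real.exp (-(β * (u s - u τ))) ≤ 1 := Real.exp_le_one_iff.2 (by
          have := mul_nonneg hS.β_nonneg (sub_nonneg.2 (hS.rate.monotone h))
          linarith)
        have hK := hS.K_nonneg
        calc K * Real.exp (-(β * (u s - u τ))) * Real.exp (ν * |u s|) * ‖y s - y' s‖
            ≤ K * 1 * Real.exp (ν * |u s|) * ‖y s - y' s‖ := by gcongr
          _ = M₁ * ‖y s - y' s‖ := by rw [mul_one]
          _ ≤ _ := by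
              gcongr
              linarith
      · rw [hy.eq s τ h, hy'.eq s τ h]
        refine (hS.bound.isField_zero.norm_flow_sub_le hS.r_pos.le h _ _).trans ?_
        have h1 : ∫ σ in s..τ, ℓ σ ≤ ∫ σ in s..A, ℓ σ :=
          integral_mono_right hS.bound.locallyIntegrable hS.bound.nonneg s hτA
        calc 2 * ‖y s - y' s‖ * Real.exp (2 * ∫ σ in s..τ, ℓ σ)
            ≤ 2 * ‖y s - y' s‖ * Real.exp (2 * ∫ σ in s..A, ℓ σ) := by gcongr
          _ = M₂ * ‖y s - y' s‖ := by ring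
          _ ≤ _ := by
              gcongr
              linarith
    calc _ ≤ ‖y τ - y' τ‖ * 1 := by
          gcongr
          exact min_le_right _ _
      _ ≤ (M₁ + M₂) * (d / (M₁ + M₂)) := by
          rw [mul_one]
          exact hnear.trans (by gcongr)
      _ = d := by field_simp

end Nonlinear

/-! ### The conjugacy on the unstable bundle -/

section Conjugacy

variable {r : ℝ} {E : Type u} [NormedAddCommGroup E] [NormedSpace ℝ E] [CompleteSpace E]
  [FiniteDimensional ℝ E] {η : Kernel r E} {P : ℝ → Phase r E →L[ℝ] Phase r E}
  {ℓ u : ℝ → ℝ} {n K α β θ ν ε C δ κ : ℝ} {g : ℝ → Phase r E → E}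

/-- Perron's method for the delay equation: the constant `C` in terms of those of the dichotomy
and of a bound for `T(t,s)` over times at most `r`. -/
theorem IsLogDichotomy.isPerronSystem (hr : 0 < r) (hL : IsLBound η ℓ) (hu : IsLogRate u r n)
    (hD : IsLogDichotomy (linFlow η) P u K α β θ ν) (hK : 0 ≤ K) (hα : 0 < α) (hβ : 0 < β)
    (hν : 0 ≤ ν) (hνθ : ν ≤ θ) (hθα : θ < α) (hνβ : ν < β) (hε : 0 ≤ ε) {A B : ℝ} (hB0 : 0 ≤ B)
    (hA : A = 4 * B * Real.exp ((θ + 2 * ε) * n))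
    (hB : ∀ s t, s ≤ t → t ≤ s + r → ∀ φ,
      ‖linFlow η t s φ‖ ≤ B * Real.exp (ε * |u s|) * ‖φ‖) :
    IsPerronSystem η P ℓ u n K α β θ ν ε (K * A * (Real.exp (α * n) / α) + K * A / β) := by
  have hA0 : 0 ≤ A := by rw [hA]; positivity
  refine ⟨hr, hL, hu, hD, hK, by positivity, hβ.le, hθα, hνβ, fun f D hf hD0 hfD => ?_⟩
  obtain ⟨z, hz, hzC⟩ := hD.exists_bounded_solution (A := A * D) (V := response η f)
    (hL.isEvolution hr.le) hK (by positivity) hα hβ hνθ hr hu.monotone hu.tendsto_atBot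
    hu.tendsto_atTop hu.step (hL.response_cocycle hr.le hf.locallyIntegrable)
    (fun {s t} hst hts => by
      rw [hA]
      exact hL.norm_response_le_of_growth hr.le hu hf.locallyIntegrable hε (hν.trans hνθ) hB0 hD0
        hB hfD hst hts)
  exact ⟨z, hz, fun t => (hzC t).trans (le_of_eq (by ring))⟩

theorem IsLogPerturbation.R_eq (hg : IsLogPerturbation u g δ κ) (hr : 0 ≤ r) (hL : IsLBound η ℓ)
    (hu : IsLogRate u r n) (hδ : 0 ≤ δ) (hκ : 0 ≤ κ) {s t : ℝ} (hst : s ≤ t) (φ : Phase r E) :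
    R η g t s φ = flow (perturbed η g) t s φ := by
  rw [R, evolution_eq_flow hr (hg.isField hL hu hδ hκ)
    (fun t ψ => by rw [perturbed, toPhase_coe, Kernel.LC_apply]) hst φ, toPhase_coe]

/-- Convergence of base points in the unstable bundle makes the orbits through them, and with them
the deviations, converge at an earlier time; flowing forward again, the deviations converge at the
base points. -/
theorem tendsto_deviation (hS : IsPerronSystem η P ℓ u n K α β θ ν ε C)
    (hg : IsLogPerturbation u g δ κ) (hδ : 0 ≤ δ) (hδC : C * δ ≤ 1 / 2) (hκ : θ + ε < κ)
    (hκ0 : 0 ≤ κ) {X : Type*} {l : Filter X} {τ : X → ℝ} {y : X → ℝ → Phase r E}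
    {v : X → BoundedContinuousFunction ℝ (Phase r E)} (hy : ∀ p, IsOrbit (linFlow η) P (y p))
    (hv : ∀ p, IsDeviation η g (y p) (v p)) {t₀ : ℝ} {y₀ : ℝ → Phase r E}
    {v₀ : BoundedContinuousFunction ℝ (Phase r E)} (hy₀ : IsOrbit (linFlow η) P y₀)
    (hv₀ : IsDeviation η g y₀ v₀) (hτ : Tendsto τ l (𝓝 t₀))
    (hb : Tendsto (fun p => y p (τ p)) l (𝓝 (y₀ t₀))) :
    Tendsto (fun p => v p (τ p)) l (𝓝 (v₀ t₀)) := by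
  have hT := hS.isEvolution
  have hr := hS.r_pos.le
  set s := t₀ - 1 with hs
  have hst : s < t₀ := by rw [hs]; linarith
  have hys : Tendsto (fun p => y p s - y₀ s) l (𝓝 0) := by
    have h1 : Tendsto (fun p => y p (τ p) - y₀ (τ p)) l (𝓝 0) := by
      simpa using hb.sub (((hy₀.continuous hS).tendsto t₀).comp hτ)
    have hu := hS.rate.differentiable.continuous
    have h2 : Continuous fun t => K * Real.exp (-(β * (u t - u s))) * Real.exp (ν * |u t|) := by
      fun_prop
    have h3 := ((h2.tendsto t₀).comp hτ).mul h1.norm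
    rw [norm_zero, mul_zero] at h3
    refine squeeze_zero_norm' ?_ h3
    filter_upwards [hτ.eventually (lt_mem_nhds hst)] with p hp
    exact (hy p).norm_sub_le hT hS.dichotomy hy₀ hp.le
  have hvs : Tendsto (fun p => v p s - v₀ s) l (𝓝 0) := by
    rw [Metric.tendsto_nhds]
    intro d hd
    obtain ⟨ρ, hρ, h⟩ :=
      IsOrbit.exists_forall_min_le hS (sub_pos.2 hκ) s (half_pos hd)
    filter_upwards [Metric.tendsto_nhds.1 hys ρ hρ] with p hp
    rw [dist_zero_right] at hp ⊢
    have h4 := (hv p).norm_sub_le hS hg hδ hδC hκ.le (hy p) hy₀ hv₀ (half_pos hd).le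
      (h _ _ (hy p) hy₀ hp.le)
    have h5 := (v p - v₀).norm_coe_le_norm s
    rw [BoundedContinuousFunction.sub_apply] at h5
    linarith
  have hsum : Tendsto (fun p => y p s + v p s) l (𝓝 (y₀ s + v₀ s)) := by
    have := (hys.add hvs).add_const (y₀ s + v₀ s)
    rw [add_zero, zero_add] at this
    refine this.congr fun p => ?_
    abel
  have hflow := (hg.isField hS.bound hS.rate hδ hκ0).tendsto_flow hr hst hτ hsum
  rw [← (isDeviation_iff hS hg hδ hκ0 hy₀).1 hv₀ s t₀ hst.le] at hflow
  have h6 : Tendsto (fun p => y p (τ p) + v p (τ p)) l (𝓝 (y₀ t₀ + v₀ t₀)) := by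
    refine hflow.congr' ?_
    filter_upwards [hτ.eventually (lt_mem_nhds hst)] with p hp
    exact ((isDeviation_iff hS hg hδ hκ0 (hy p)).1 (hv p) s (τ p) hp.le).symm
  have h7 := h6.sub hb
  simpa using h7

variable {μ : ℝ → ℝ} {hP : IsDichotomy η μ P K α β θ ν}
  {ζ : BoundedContinuousFunction (UnstableBundle P) (Phase r E)}

/-- A bounded function on the unstable bundle is a conjugacy if and only if it restricts to a
deviation along every orbit. -/
theorem isConjugacy_iff (hS : IsPerronSystem η P ℓ u n K α β θ ν ε C)
    (hg : IsLogPerturbation u g δ κ) (hδ : 0 ≤ δ) (hκ0 : 0 ≤ κ) :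
    IsConjugacy hP g ζ ↔ ∀ (y : ℝ → Phase r E) (v : BoundedContinuousFunction ℝ (Phase r E)),
      IsOrbit (linFlow η) P y → (∀ τ (hτ : y τ ∈ U P τ), v τ = ζ ⟨(τ, y τ), hτ⟩) →
      IsDeviation η g y v := by
  have hr := hS.r_pos.le
  have hT := hS.isEvolution
  have hmem {y : ℝ → Phase r E} (hy : IsOrbit (linFlow η) P y) (τ : ℝ) : y τ ∈ U P τ :=
    (hP.mem_U_iff τ _).2 (hy.mem τ)
  constructor
  · intro hζ y v hy hv
    rw [isDeviation_iff hS hg hδ hκ0 hy]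
    intro s t hst
    have h1 := hζ s t hst ⟨y s, hmem hy s⟩
    have h2 : T η t s (y s) = y t := by rw [hS.bound.T_eq hr hst, ← hy.eq s t hst]
    rw [hg.R_eq hr hS.bound hS.rate hδ hκ0 hst] at h1
    simp only [h, h2] at h1
    rw [hv t (hmem hy t), hv s (hmem hy s)]
    exact h1
  · intro hζ s t hst b
    obtain ⟨y, hy, hyb⟩ := hS.dichotomy.exists_isOrbit hT ((hP.mem_U_iff s _).1 b.2)
    have hc : Continuous fun τ => (⟨(τ, y τ), hmem hy τ⟩ : UnstableBundle P) :=
      (continuous_id.prodMk (hy.continuous hS)).subtype_mk _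
    have hv := hζ y (ζ.compContinuous ⟨_, hc⟩) hy fun τ _ => rfl
    have h1 := (isDeviation_iff hS hg hδ hκ0 hy).1 hv s t hst
    have h2 : T η t s b = y t := by rw [hS.bound.T_eq hr hst, hy.eq s t hst, hyb]
    rw [hg.R_eq hr hS.bound hS.rate hδ hκ0 hst]
    simp only [h, h2]
    simp only [BoundedContinuousFunction.compContinuous_apply, ContinuousMap.coe_mk, hyb] at h1
    exact h1

/-- Any two conjugacies coincide. -/
theorem IsConjugacy.ext (hS : IsPerronSystem η P ℓ u n K α β θ ν ε C)
    (hg : IsLogPerturbation u g δ κ) (hδ : 0 ≤ δ) (hδC : C * δ ≤ 1 / 2) (hκ : θ + ε ≤ κ)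
    (hκ0 : 0 ≤ κ) {ζ' : BoundedContinuousFunction (UnstableBundle P) (Phase r E)}
    (hζ : IsConjugacy hP g ζ) (hζ' : IsConjugacy hP g ζ') : ζ = ζ' := by
  ext1 ⟨⟨s, b⟩, hb⟩
  obtain ⟨y, hy, rfl⟩ := hS.dichotomy.exists_isOrbit hS.isEvolution ((hP.mem_U_iff s b).1 hb)
  have hc : Continuous fun τ =>
      (⟨(τ, y τ), (hP.mem_U_iff τ _).2 (hy.mem τ)⟩ : UnstableBundle P) :=
    (continuous_id.prodMk (hy.continuous hS)).subtype_mk _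
  have h1 := (isConjugacy_iff hS hg hδ hκ0).1 hζ y (ζ.compContinuous ⟨_, hc⟩) hy fun τ _ => rfl
  have h2 := (isConjugacy_iff hS hg hδ hκ0).1 hζ' y (ζ'.compContinuous ⟨_, hc⟩) hy fun τ _ => rfl
  exact DFunLike.congr_fun (h1.ext hS hg hδ hδC hκ hy h2) s

/-- The conjugacy: at a point of the unstable bundle, the value of the deviation from the orbit
through this point. -/
theorem exists_isConjugacy (hS : IsPerronSystem η P ℓ u n K α β θ ν ε C)
    (hg : IsLogPerturbation u g δ κ) (hδ : 0 ≤ δ) (hδC : C * δ ≤ 1 / 2) (hκ : θ + ε < κ)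
    (hκ0 : 0 ≤ κ) (hP : IsDichotomy η μ P K α β θ ν) : ∃ ζ, IsConjugacy hP g ζ := by
  have hT := hS.isEvolution
  have hex (p : UnstableBundle P) : ∃ y v, (IsOrbit (linFlow η) P y ∧ y p.1.1 = p.1.2) ∧
      IsDeviation η g y v ∧ ‖v‖ ≤ C * δ := by
    obtain ⟨y, hy, hyp⟩ := hS.dichotomy.exists_isOrbit hT ((hP.mem_U_iff _ _).1 p.2)
    obtain ⟨v, hv⟩ := exists_isDeviation hS hg hδ hδC hκ.le hy
    exact ⟨y, v, ⟨hy, hyp⟩, hv⟩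
  choose y v hy hv using hex
  have hc : Continuous fun p => v p p.1.1 := by
    refine continuous_iff_continuousAt.2 fun p₀ => ?_
    refine tendsto_deviation hS hg hδ hδC hκ hκ0 (fun p => (hy p).1) (fun p => (hv p).1)
      (hy p₀).1 (hv p₀).1 (continuous_subtype_val.fst.tendsto p₀) ?_
    simp only [(hy _).2]
    exact continuous_subtype_val.snd.tendsto p₀
  refine ⟨BoundedContinuousFunction.ofNormedAddCommGroup _ hc (C * δ)
    fun p => ((v p).norm_coe_le_norm _).trans (hv p).2, ?_⟩
  rw [isConjugacy_iff hS hg hδ hκ0]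
  intro y' v' hy' hv'
  obtain ⟨w, hw, -⟩ := exists_isDeviation hS hg hδ hδC hκ.le hy'
  have : v' = w := by
    ext1 τ
    have hτ : y' τ ∈ U P τ := (hP.mem_U_iff τ _).2 (hy'.mem τ)
    rw [hv' τ hτ]
    have h1 : y ⟨(τ, y' τ), hτ⟩ = y' := (hy _).1.ext hT hS.dichotomy hy' (hy ⟨(τ, y' τ), hτ⟩).2
    have h2 := (hv ⟨(τ, y' τ), hτ⟩).1
    rw [h1] at h2
    exact DFunLike.congr_fun (h2.ext hS hg hδ hδC hκ.le hy' hw) τ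
  rwa [this]

/-- The maps `Id + ζ(t,·)` are embeddings: if the images of `b` and `b₀` are close, then so are
their images under `R(τ,t)` for any given `τ ≥ t`. Up to a bounded error these are `T(τ,t)b` and
`T(τ,t)b₀`, and `T(τ,t)` expands differences by an arbitrarily large factor if `τ` is large. -/
theorem IsConjugacy.isEmbedding (hS : IsPerronSystem η P ℓ u n K α β θ ν ε C)
    (hg : IsLogPerturbation u g δ κ) (hδ : 0 ≤ δ) (hκ0 : 0 ≤ κ) (hζ : IsConjugacy hP g ζ)
    (t : ℝ) : Topology.IsEmbedding (h ζ t) := by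
  have hr := hS.r_pos.le
  have hT := hS.isEvolution
  have hcont : Continuous (h ζ t) := by
    refine continuous_subtype_val.add (ζ.continuous.comp ?_)
    exact (continuous_const.prodMk continuous_subtype_val).subtype_mk _
  refine (isInducing_iff_nhds.2 fun b₀ =>
    le_antisymm (hcont.tendsto b₀).le_comap ?_).isEmbedding
  rw [nhds_subtype, ← tendsto_iff_comap, tendsto_iff_norm_sub_tendsto_zero]
  rw [Metric.tendsto_nhds]
  intro ε' hε'
  -- a time `τ` at which a difference of size `1 + 2‖ζ‖` stems from one of size less than `ε'`
  obtain ⟨τ, hτ, htτ⟩ : ∃ τ, K * (1 + 2 * ‖ζ‖) *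
      (Real.exp (-(β * (u τ - u t))) * Real.exp (ν * |u τ|)) < ε' ∧ t ≤ τ := by
    have h1 := (tendsto_unstable_weight hS.ν_lt hS.rate.tendsto_atTop (u t)).const_mul
      (K * (1 + 2 * ‖ζ‖))
    rw [mul_zero] at h1
    exact ((h1.eventually (gt_mem_nhds hε')).and (eventually_ge_atTop t)).exists
  have hR : Continuous (flow (perturbed η g) τ t) :=
    (hg.isField hS.bound hS.rate hδ hκ0).continuous_flow hr htτ
  have hlim : Tendsto (fun b => flow (perturbed η g) τ t (h ζ t b)) (comap (h ζ t) (𝓝 (h ζ t b₀)))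
      (𝓝 (flow (perturbed η g) τ t (h ζ t b₀))) := (hR.tendsto _).comp tendsto_comap
  filter_upwards [Metric.tendsto_nhds.1 hlim 1 one_pos] with b hb
  have hconj (c : U P t) : ∃ w, ‖w‖ ≤ ‖ζ‖ ∧
      flow (perturbed η g) τ t (h ζ t c) = linFlow η τ t c + w := by
    refine ⟨_, ζ.norm_coe_le_norm ⟨(τ, T η τ t c), (hP.bijOn t τ htτ).mapsTo c.2⟩, ?_⟩
    rw [← hg.R_eq hr hS.bound hS.rate hδ hκ0 htτ, ← hζ t τ htτ c, ← hS.bound.T_eq hr htτ]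
    rfl
  obtain ⟨w, hw, hwb⟩ := hconj b
  obtain ⟨w₀, hw₀, hwb₀⟩ := hconj b₀
  rw [hwb, hwb₀, dist_eq_norm] at hb
  have h1 : ‖linFlow η τ t (b - b₀)‖ ≤ 1 + 2 * ‖ζ‖ := by
    have h2 : linFlow η τ t (b - b₀) =
        (linFlow η τ t b + w - (linFlow η τ t b₀ + w₀)) - (w - w₀) := by
      rw [hT.sub htτ]
      abel
    rw [h2]
    refine (norm_sub_le _ _).trans ?_
    linarith [norm_sub_le w w₀]
  have h3 := hS.dichotomy.norm_le hT htτ (b := (b - b₀ : Phase r E)) (by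
    rw [map_sub, (hP.mem_U_iff _ _).1 b.2, (hP.mem_U_iff _ _).1 b₀.2, sub_zero])
  rw [dist_zero_right, norm_norm]
  have hK := hS.K_nonneg
  calc ‖(b : Phase r E) - b₀‖ ≤ K * Real.exp (-(β * (u τ - u t))) * Real.exp (ν * |u τ|) *
        (1 + 2 * ‖ζ‖) := h3.trans (by gcongr)
    _ = _ := by ring
    _ < ε' := hτ

omit [NormedSpace ℝ E] [CompleteSpace E] [FiniteDimensional ℝ E] in
theorem IsPerturbation.isLogPerturbation {γ : ℝ} (hμ : IsDiffGrowthRate μ)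
    (hg : IsPerturbation μ g δ γ ε) :
    IsLogPerturbation (fun t => Real.log (μ t)) g δ (γ + ε) where
  continuous := hg.continuous
  map_zero := hg.map_zero
  lipschitz t φ ψ := by
    have := hg.lipschitz t φ ψ
    rwa [mul_assoc, hμ.deriv_mul_rpow] at this

end Conjugacy

end DelayEq

end

open DelayEq in
theorem mainTheorem2 {E : Type*} [NormedAddCommGroup E] [NormedSpace ℝ E] [FiniteDimensional ℝ E]
    [CompleteSpace E] {r : ℝ} (hr : 0 < r) {K α β θ ν K' a ε N : ℝ}
    (hK : 1 ≤ K) (hα : 0 < α) (hβ : 0 < β) (hθ : 0 ≤ θ) (hν : 0 ≤ ν) (hαθ : θ < α) (hβν : ν < β)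
    (hK' : 1 ≤ K') (ha : 0 ≤ a) (hε : 0 < ε) (hN : 1 < N)
    (h₁ : ε + ν ≤ θ) (h₂ : θ + ε < α) (h₃ : ν + ε < β) :
    ∃ δ₀ : ℝ, 0 < δ₀ ∧
      ∀ (η : Kernel r E) (μ : ℝ → ℝ) (P : ℝ → Phase r E →L[ℝ] Phase r E),
        IsDiffGrowthRate μ → (∀ s, μ (s + r) / μ s ≤ N) → HasBoundedGrowth η μ K' a ε →
        ∀ (hP : IsDichotomy η μ P K α β θ ν) (γ δ : ℝ) (g : ℝ → Phase r E → E),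
          max θ ν < γ → 0 < δ → δ ≤ δ₀ → IsPerturbation μ g δ γ ε →
          ∃ ζ : BoundedContinuousFunction (UnstableBundle P) (Phase r E),
            IsConjugacy hP g ζ ∧
            (∀ ζ', IsConjugacy hP g ζ' → ζ' = ζ) ∧
            ∀ t, Topology.IsEmbedding (h ζ t) := by
  set B := K' * Real.exp (a * Real.log N) with hB
  set A := 4 * B * Real.exp ((θ + 2 * ε) * Real.log N) with hA
  set C := K * A * (Real.exp (α * Real.log N) / α) + K * A / β with hC
  have hK0 : 0 < K := by linarith
  have hK'0 : 0 < K' := by linarith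
  have hB0 : 0 < B := by positivity
  have hC0 : 0 < C := by positivity
  refine ⟨1 / (2 * C), by positivity, ?_⟩
  intro η μ P hμ hμN hG hP γ δ g hγ hδ hδ₀ hg
  obtain ⟨ℓ, hℓ, hℓ0, hℓn⟩ := η.exists_norm_LC_le hr
  have hL : IsLBound η ℓ := ⟨hℓ, hℓ0, hℓn⟩
  have hu := hμ.isLogRate (r := r) hμN
  have hS := (hP.isLogDichotomy hr.le hL hμ).isPerronSystem hr hL hu hK0.le hα hβ hν
    (by linarith) hαθ hβν hε.le hB0.le hA
    (hG.norm_linFlow_le hr.le hL hμ hμN (by linarith) ha)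
  have hg' := hg.isLogPerturbation hμ
  have hθγ : θ < γ := (le_max_left _ _).trans_lt hγ
  have hδC : C * δ ≤ 1 / 2 := by
    calc C * δ ≤ C * (1 / (2 * C)) := by gcongr
      _ = 1 / 2 := by field_simp
  obtain ⟨ζ, hζ⟩ := exists_isConjugacy hS hg' hδ.le hδC (by linarith) (by linarith) hP
  exact ⟨ζ, hζ, fun ζ' hζ' => hζ'.ext hS hg' hδ.le hδC (by linarith) (by linarith) hζ,
    hζ.isEmbedding hS hg' hδ.le (by linarith)⟩
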